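/- Work in the theory $\mathbf{SPOT}$, whose language has the predicates $\in$ and $\mathrm{st}$ ("standard") and whose axioms are $\mathbf{ZF}$ (schemata for $\in$-formulas), Transfer ($\forall^{\mathrm{st}}x\,\phi(x)\to\forall x\,\phi(x)$ for $\in$-formulas $\phi$ with standard parameters), Nontriviality (there is a nonstandard $\nu\in\mathbb N$) and Standard Part (for every $A\subseteq\mathbb N$ there is a standard $B\subseteq\mathbb N$ with the same standard elements); equivalently, the following holds in every model of $\mathbf{SPOT}$. A real number is limited if its absolute value is at most some standard $n\in\mathbb N$, and $x\approx r$ means $|x-r|\le 1/n$ for all standard $n\in\mathbb N$, $n\ne0$. Let $F:[0,\infty)\times\mathbb R\to\mathbb R$ be a standard continuous function, and consider the initial value problem $$(\ast)\qquad y(0)=0,\qquad y'(x)=F(x,y(x)),$$ where the derivative at an endpoint of the domain of $y$ is one-sided. Let $N\in\mathbb N$ be unlimited, $h=1/N$, $x_0\ge 0$, $x_0\approx 0$, $y_0\approx 0$, and $x_k=x_0+kh$ for $k=0,\dots,N^2$. An infinitesimal perturbation is a sequence $\boldsymbol\varepsilon=\langle\varepsilon_k\mid k<N^2\rangle$ of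 reals (a set of the theory) such that each $\varepsilon_k\approx 0$. It determines a sequence $\langle y_k \mid k\le N^2\rangle$ by $y_{k+1}=y_k+(F(x_k,y_k)+\varepsilon_k)h$ for $k<N^2$, starting with the given $y_0$. Let $Y$ be the standard subset of $[0,\infty)\times\mathbb R$ whose standard elements are exactly the standard pairs $\langle x,y\rangle$ with $x\approx x_k$ and $y\approx y_k$ for some $k<N^2$. The standard function $y_{\boldsymbol\varepsilon}$ is the restriction of $Y$ to the connected component of $0$ in the domain $\{x\mid \exists z\ \langle x,z\rangle\in Y\}$. **Lemma.** For every standard solution $y$ of $(\ast)$ defined on a standard interval $[0,a)$ (with $a$ a real number or $\infty$) and every standard $c$ with $0<c<a$, there is an infinitesimal perturbation $\boldsymbol\varepsilon$ such that $y_{\boldsymbol\varepsilon}(x)$ is defined and $y(x)=y_{\boldsymbol\varepsilon}(x)$ for all $x$ with $0\le x\le c$. Moreover, $\boldsymbol\varepsilon$ can be chosen so that, for each $k<N^2$: if $x_{k+1}\le c$, then there is $t_k\in[x_k,x_{k+1}]$ with $y(x_{k+1})-y(x_k)=y'(t_k)\,h$ and $\varepsilon_k=y'(t_k)-F(x_k,y_k)$;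 and if $x_{k+1}>c$, then $\varepsilon_k=0$. -/

import Mathlib

/-! ## Structures for the language of membership and standardness -/

/-- A universe of (internal) sets: an interpretation of the binary predicate "is an element of" and
of the unary predicate "is standard". -/
class SetUniverse (M : Type*) where
  /-- `mem x s` : the set `x` is an element of the set `s`. -/
  mem : M → M → Prop
  /-- `std x` : the set `x` is standard. -/
  std : M → Prop

infix:50 " ∈ₘ " => SetUniverse.mem

/-- The only nonlogical symbol of the language of set theory: a binary relation symbol. -/
inductive MemSymbol : ℕ → Type
  | mem : MemSymbol 2

/-- The first-order language of set theory (it does not contain the predicate `std`). -/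
def MemLanguage : FirstOrder.Language := ⟨fun _ => Empty, MemSymbol⟩

instance SetUniverse.memStructure (M : Type*) [SetUniverse M] : MemLanguage.Structure M where
  funMap := fun f => Empty.elim f
  RelMap := fun r v => match r, v with
    | MemSymbol.mem, v => v 0 ∈ₘ v 1

namespace SetUniverse

/-! ## Basic set-theoretic notions inside a universe -/

section Basic

variable {M : Type*} [SetUniverse M]

/-- `p = {a, b}` -/
def IsUnorderedPair (p a b : M) : Prop := ∀ z, z ∈ₘ p ↔ z = a ∨ z = b

/-- `p = ⟨a, b⟩ = {{a}, {a, b}}` (Kuratowski pair) -/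
def IsPair (p a b : M) : Prop :=
  ∀ z, z ∈ₘ p ↔ IsUnorderedPair z a a ∨ IsUnorderedPair z a b

/-- `⟨a, b⟩ ∈ r` -/
def PairMem (r a b : M) : Prop := ∃ p, IsPair p a b ∧ p ∈ₘ r

/-- `s` contains the empty set and is closed under `x ↦ x ∪ {x}`. -/
def IsInductive (s : M) : Prop :=
  (∃ e, e ∈ₘ s ∧ ∀ z, ¬ z ∈ₘ e) ∧
    ∀ x, x ∈ₘ s → ∃ t, t ∈ₘ s ∧ ∀ z, z ∈ₘ t ↔ z ∈ₘ x ∨ z = x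

/-- `n ∈ ℕ`, where `ℕ` is the least inductive set. -/
def IsNatural (n : M) : Prop := ∀ s, IsInductive s → n ∈ₘ s

end Basic

end SetUniverse

open SetUniverse

/-! ## The theory SPOT -/

/-- The axioms of Zermelo–Fraenkel set theory. The two schemata range over all formulas of the
language of set theory, with arbitrary parameters. -/
structure IsZF (M : Type*) [SetUniverse M] : Prop where
  extensionality : ∀ a b : M, (∀ z, z ∈ₘ a ↔ z ∈ₘ b) → a = b
  foundation : ∀ a : M, (∃ x, x ∈ₘ a) → ∃ x, x ∈ₘ a ∧ ∀ z, z ∈ₘ x → ¬ z ∈ₘ a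
  pairing : ∀ a b : M, ∃ p, IsUnorderedPair p a b
  union : ∀ a : M, ∃ u, ∀ z, z ∈ₘ u ↔ ∃ x, x ∈ₘ a ∧ z ∈ₘ x
  power : ∀ a : M, ∃ p, ∀ x, x ∈ₘ p ↔ ∀ z, z ∈ₘ x → z ∈ₘ a
  infinity : ∃ s : M, IsInductive s
  separation : ∀ D : Set M, Set.Definable₁ (Set.univ : Set M) MemLanguage D →
    ∀ a : M, ∃ b, ∀ x, x ∈ₘ b ↔ x ∈ₘ a ∧ x ∈ D
  replacement : ∀ D : Set (M × M), Set.Definable₂ (Set.univ : Set M) MemLanguage D →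
    ∀ a : M, (∀ x, x ∈ₘ a → ∃! y, (x, y) ∈ D) →
      ∃ b, ∀ y, y ∈ₘ b ↔ ∃ x, x ∈ₘ a ∧ (x, y) ∈ D

/-- The axioms of SPOT: ZF (in the language of set theory), Transfer, Nontriviality and
Standard Part. -/
structure IsSPOT (M : Type*) [SetUniverse M] : Prop extends IsZF M where
  /-- For every formula `φ(x)` of the language of set theory with standard parameters: if `φ(x)`
  holds for all standard `x`, then it holds for all `x`. -/
  transfer : ∀ D : Set M, Set.Definable₁ {x : M | std x} MemLanguage D →
    (∀ x, std x → x ∈ D) → ∀ x, x ∈ D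
  nontriviality : ∃ ν : M, IsNatural ν ∧ ∀ n, std n → IsNatural n → n ≠ ν
  standard_part : ∀ A : M, (∀ n, n ∈ₘ A → IsNatural n) →
    ∃ B : M, std B ∧ (∀ n, n ∈ₘ B → IsNatural n) ∧
      ∀ n, std n → IsNatural n → (n ∈ₘ B ↔ n ∈ₘ A)

/-! ## The real numbers of a universe -/

/-- The standard ordered field of real numbers inside a universe: a standard set, with standard
addition, multiplication and order, that is a complete ordered field in the sense of the universe
(completeness concerns the subsets that are sets of the universe). Inside a model of ZF such a
field is unique up to an isomorphism in the model. -/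
structure RealLine (M : Type*) [SetUniverse M] where
  /-- the set of real numbers -/
  carrier : M
  field : Field {x : M // x ∈ₘ carrier}
  order : LinearOrder {x : M // x ∈ₘ carrier}
  strictOrderedRing : IsStrictOrderedRing {x : M // x ∈ₘ carrier}
  /-- addition, as a set of pairs `⟨⟨x, y⟩, x + y⟩` -/
  addGraph : M
  /-- multiplication, as a set of pairs `⟨⟨x, y⟩, x * y⟩` -/
  mulGraph : M
  /-- the order, as a set of pairs `⟨x, y⟩` with `x < y` -/
  ltGraph : M
  mem_addGraph : ∀ p, p ∈ₘ addGraph ↔ ∃ (x y : {x : M // x ∈ₘ carrier}) (q : M),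
    IsPair q x.1 y.1 ∧ IsPair p q (x + y).1
  mem_mulGraph : ∀ p, p ∈ₘ mulGraph ↔ ∃ (x y : {x : M // x ∈ₘ carrier}) (q : M),
    IsPair q x.1 y.1 ∧ IsPair p q (x * y).1
  mem_ltGraph : ∀ p, p ∈ₘ ltGraph ↔ ∃ x y : {x : M // x ∈ₘ carrier},
    x < y ∧ IsPair p x.1 y.1
  complete : ∀ A : M, (∀ x, x ∈ₘ A → x ∈ₘ carrier) → (∃ x, x ∈ₘ A) →
    (∃ b : {x : M // x ∈ₘ carrier}, ∀ x : {x : M // x ∈ₘ carrier}, x.1 ∈ₘ A → x ≤ b) →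
    ∃ s : {x : M // x ∈ₘ carrier}, IsLUB {x : {x : M // x ∈ₘ carrier} | x.1 ∈ₘ A} s
  std_carrier : std carrier
  std_addGraph : std addGraph
  std_mulGraph : std mulGraph
  std_ltGraph : std ltGraph

namespace RealLine

variable {M : Type*} [SetUniverse M]

/-- The real numbers of the universe. -/
abbrev Pt (R : RealLine M) : Type _ := {x : M // x ∈ₘ R.carrier}

instance (R : RealLine M) : Field R.Pt := R.field
instance (R : RealLine M) : LinearOrder R.Pt := R.order
instance (R : RealLine M) : IsStrictOrderedRing R.Pt := R.strictOrderedRing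

variable (R : RealLine M)

/-- The natural numbers as real numbers: the least set (of the universe) of reals that contains `0`
and is closed under `x ↦ x + 1`. -/
def naturals : Set R.Pt :=
  {n | ∀ s : M, (0 : R.Pt).1 ∈ₘ s → (∀ x : R.Pt, x.1 ∈ₘ s → (x + 1).1 ∈ₘ s) → n.1 ∈ₘ s}

variable {R}

/-- `|x| ≤ n` for some standard natural number `n`. -/
def Limited (x : R.Pt) : Prop := ∃ n ∈ R.naturals, std n.1 ∧ |x| ≤ n

/-- `x ≈ r`: `|x - r| ≤ 1 / n` for all standard natural numbers `n ≠ 0`. -/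
def Near (x r : R.Pt) : Prop := ∀ n ∈ R.naturals, std n.1 → n ≠ 0 → |x - r| ≤ 1 / n

/-! ### Functions of the universe

A function of the universe with domain `D` is handled through a map `f : R.Pt → R.Pt` whose
restriction to `D` has a set of the universe as its graph; values of `f` outside `D` are never
used. -/

/-- The set `G` is the graph of the restriction of `f` to `D`. -/
def IsGraphOn (D : Set R.Pt) (f : R.Pt → R.Pt) (G : M) : Prop :=
  ∀ p, p ∈ₘ G ↔ ∃ x ∈ D, IsPair p x.1 (f x).1

/-- The restriction of `f` to `D` is a function that belongs to the universe. -/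
def InternalOn (D : Set R.Pt) (f : R.Pt → R.Pt) : Prop := ∃ G : M, IsGraphOn D f G

/-- The restriction of `f` to `D` is a standard function. -/
def StandardOn (D : Set R.Pt) (f : R.Pt → R.Pt) : Prop := ∃ G : M, std G ∧ IsGraphOn D f G

/-- The restriction of `F` to `[0, ∞) × ℝ` is a standard function. -/
def StandardField (F : R.Pt → R.Pt → R.Pt) : Prop :=
  ∃ G : M, std G ∧ ∀ p, p ∈ₘ G ↔ ∃ (x y : R.Pt) (q : M),
    0 ≤ x ∧ IsPair q x.1 y.1 ∧ IsPair p q (F x y).1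

/-- `F` is continuous on `[0, ∞) × ℝ`, in the sense of the universe. -/
def ContinuousField (F : R.Pt → R.Pt → R.Pt) : Prop :=
  ∀ x y : R.Pt, 0 ≤ x → ∀ η : R.Pt, 0 < η → ∃ δ : R.Pt, 0 < δ ∧
    ∀ x' y' : R.Pt, 0 ≤ x' → |x' - x| < δ → |y' - y| < δ → |F x' y' - F x y| < η

/-- `f` has derivative `d` at `x` relative to the interval `D` (one-sided if `x` is an endpoint of
`D`), in the sense of the universe. -/
def HasDerivOn (D : Set R.Pt) (f : R.Pt → R.Pt) (d x : R.Pt) : Prop :=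
  ∀ η : R.Pt, 0 < η → ∃ δ : R.Pt, 0 < δ ∧
    ∀ z ∈ D, |z - x| < δ → |f z - f x - d * (z - x)| ≤ η * |z - x|

/-- The interval `[0, a)`, where `a` is a real number or `∞`. -/
def initialInterval (a : WithTop R.Pt) : Set R.Pt := {x | 0 ≤ x ∧ (x : WithTop R.Pt) < a}

/-- The endpoint `a` is `∞` or a standard real number. -/
def StandardEndpoint (a : WithTop R.Pt) : Prop := ∀ r : R.Pt, a = r → std r.1

/-- `y` is a solution of `y(0) = 0`, `y'(x) = F(x, y(x))` on `[0, a)`. -/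
def IsSolutionOn (F : R.Pt → R.Pt → R.Pt) (a : WithTop R.Pt) (y : R.Pt → R.Pt) : Prop :=
  y 0 = 0 ∧ ∀ x ∈ initialInterval a, HasDerivOn (initialInterval a) y (F x (y x)) x

/-! ### The perturbed Euler construction with step `1 / N` -/

/-- The grid point `x_k = x₀ + k * h`, where `h = 1 / N`. -/
def gridPoint (N x₀ k : R.Pt) : R.Pt := x₀ + k * (1 / N)

/-- An infinitesimal perturbation: a sequence `⟨ε_k : k < N²⟩` of the universe such that each
`ε_k ≈ 0`. -/
def IsPerturbation (N : R.Pt) (ε : R.Pt → R.Pt) : Prop :=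
  InternalOn {k | k ∈ R.naturals ∧ k < N ^ 2} ε ∧
    ∀ k ∈ R.naturals, k < N ^ 2 → Near (ε k) 0

/-- `u` is the sequence `⟨y_k : k ≤ N²⟩` of the universe with the initial value `y₀` and
`y_{k+1} = y_k + (F(x_k, y_k) + ε_k) * h` for `k < N²`. -/
def IsEulerSequence (F : R.Pt → R.Pt → R.Pt) (N x₀ y₀ : R.Pt) (ε u : R.Pt → R.Pt) : Prop :=
  InternalOn {k | k ∈ R.naturals ∧ k ≤ N ^ 2} u ∧ u 0 = y₀ ∧
    ∀ k ∈ R.naturals, k < N ^ 2 →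
      u (k + 1) = u k + (F (gridPoint N x₀ k) (u k) + ε k) * (1 / N)

/-- `Y` is the standard subset of `[0, ∞) × ℝ` whose standard elements are the standard pairs
`⟨x, y⟩` with `x ≈ x_k` and `y ≈ y_k` for some `k < N²`. -/
def IsShadow (N x₀ : R.Pt) (u : R.Pt → R.Pt) (Y : M) : Prop :=
  std Y ∧ (∀ p, p ∈ₘ Y → ∃ x y : R.Pt, 0 ≤ x ∧ IsPair p x.1 y.1) ∧
    ∀ x y : R.Pt, std x.1 → std y.1 → 0 ≤ x →
      (PairMem Y x.1 y.1 ↔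
        ∃ k ∈ R.naturals, k < N ^ 2 ∧ Near x (gridPoint N x₀ k) ∧ Near y (u k))

/-- `f`, with domain `D`, is the standard function `y_ε` determined by the Euler sequence `u`: `D` is
the connected component of `0` in the domain of the shadow `Y` of `u`, and the graph of `f` is the
restriction of `Y` to `D`. -/
def IsEulerSolution (N x₀ : R.Pt) (u : R.Pt → R.Pt) (D : Set R.Pt) (f : R.Pt → R.Pt) : Prop :=
  ∃ Y : M, IsShadow N x₀ u Y ∧
    D = Set.ordConnectedComponent {x : R.Pt | ∃ z : R.Pt, PairMem Y x.1 z.1} 0 ∧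
    (∀ x ∈ D, ∀ z : R.Pt, PairMem Y x.1 z.1 ↔ z = f x) ∧ StandardOn D f

end RealLine

/-! The perturbation makes the Euler sequence copy the increments of the solution: `u (k + 1) - u k`
is the increment of `y` over `[x_k, x_{k+1}]` as long as `x_{k+1} ≤ c`, and an unperturbed Euler
step afterwards. Up to `c` this gives `u k = y(x_k) + (y₀ - y(x₀))`, where the offset is
infinitesimal because `y` is continuous with `y(0) = 0`. By the mean value theorem the corresponding
`ε k` equals `F(t, y(t)) - F(x_k, u k)` for some `t` in `[x_k, x_{k+1}]`. Both arguments of `F` are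
infinitely close to the standard point `(s, y(s))`, where `s` is the standard part of `x_k`, so `ε k
≈ 0` by continuity of `F` at that point. Every standard `x` in `[0, c]` is infinitely close to a
grid point not beyond `c`, hence `(x, y(x))` lies in the shadow, and Transfer extends this to all
`x` in `[0, c]`.

Two points need work. The shadow has to exist, although Standard Part speaks only of subsets of ℕ;
in `exists_shadow` the sequence is recorded on rational boxes coded by natural numbers, and
overspill recovers an index from the boxes. The shadow also has to be a function; `near_of_euler`
shows that in infinitesimal time the sequence moves only infinitesimally.

All analysis takes place inside a model of ZF without choice, where only definable collections are
sets. Recursion, suprema, the intermediate and mean value theorems are therefore proved for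
definable functions, and `ε k` is defined as a difference quotient, so that no sequence of points
`t` has to be chosen. The classes `DefP` and `DefT` let instance search supply definability: with
arbitrary parameters for separation and induction, with standard parameters for Transfer. -/

/-! ## Definability with parameters, as a type class -/

section Definability

/-- The valuation `v` without its first entry. -/
def tl {M : Type*} (v : ℕ → M) : ℕ → M := fun n => v (n + 1)

/-- The valuation `v` with the additional first entry `x`. -/
def vcons {M : Type*} (x : M) (v : ℕ → M) : ℕ → M
  | 0 => x
  | n + 1 => v n

@[simp] theorem tl_vcons {M : Type*} (x : M) (v : ℕ → M) : tl (vcons x v) = v := rfl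
@[simp] theorem vcons_zero {M : Type*} (x : M) (v : ℕ → M) : vcons x v 0 = x := rfl

variable {M : Type*} [SetUniverse M]

/-- The property `P` of valuations is definable with parameters from `A`. -/
class DefP (A : Set M) (P : (ℕ → M) → Prop) : Prop where
  definable : A.Definable MemLanguage {v | P v}

/-- The function `t` of valuations is definable with parameters from `A`. -/
class DefT (A : Set M) (t : (ℕ → M) → M) : Prop where
  graph : DefP A (fun w => w 0 = t (tl w))

/-- `s` drops some number of first entries. -/
class IsShift (s : (ℕ → M) → (ℕ → M)) : Prop where
  shift : ∃ k, ∀ v n, s v n = v (n + k)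

instance : IsShift (M := M) (fun v => v) := ⟨0, fun _ _ => rfl⟩

instance (s : (ℕ → M) → (ℕ → M)) [h : IsShift s] : IsShift (fun v => tl (s v)) := by
  obtain ⟨k, hk⟩ := h
  exact ⟨k + 1, fun v n => by rw [tl, hk]; congr 1; omega⟩

instance : IsShift (M := M) tl := ⟨1, fun _ _ => rfl⟩

variable {A : Set M}

theorem DefP.of_iff {P Q : (ℕ → M) → Prop} (hP : DefP A P) (h : ∀ v, Q v ↔ P v) : DefP A Q := by
  have : Q = P := funext fun v => propext (h v)
  rwa [this]

theorem DefP.mono {B : Set M} {P : (ℕ → M) → Prop} (hP : DefP A P) (h : A ⊆ B) : DefP B P :=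
  ⟨hP.definable.mono h⟩

theorem DefP.rename {P : (ℕ → M) → Prop} (hP : DefP A P) (ρ : ℕ → ℕ) :
    DefP A (fun v => P (fun n => v (ρ n))) :=
  ⟨hP.definable.preimage_comp ρ⟩

instance DefP.and {P Q : (ℕ → M) → Prop} [hP : DefP A P] [hQ : DefP A Q] :
    DefP A (fun v => P v ∧ Q v) := ⟨hP.definable.inter hQ.definable⟩

instance DefP.or {P Q : (ℕ → M) → Prop} [hP : DefP A P] [hQ : DefP A Q] :
    DefP A (fun v => P v ∨ Q v) := ⟨hP.definable.union hQ.definable⟩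

instance DefP.not {P : (ℕ → M) → Prop} [hP : DefP A P] :
    DefP A (fun v => ¬ P v) := ⟨hP.definable.compl⟩

instance DefP.imp {P Q : (ℕ → M) → Prop} [hP : DefP A P] [hQ : DefP A Q] :
    DefP A (fun v => P v → Q v) :=
  DefP.of_iff (P := fun v => ¬ P v ∨ Q v) inferInstance fun v => by tauto

instance DefP.iff {P Q : (ℕ → M) → Prop} [hP : DefP A P] [hQ : DefP A Q] :
    DefP A (fun v => P v ↔ Q v) :=
  DefP.of_iff (P := fun v => (P v → Q v) ∧ (Q v → P v)) inferInstance fun v => by tauto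

/-- A condition that ignores the valuation cuts out everything or nothing, so `p` itself need not be
expressible by a formula. -/
theorem DefP.const (p : Prop) : DefP A (fun _ => p) := by
  by_cases hp : p
  · exact ⟨by simp [hp]⟩
  · exact ⟨by simp [hp]⟩

instance : DefP A (fun _ => False) := DefP.const _

instance DefP.ex {P : (ℕ → M) → M → Prop} [hP : DefP A (fun w => P (tl w) (w 0))] :
    DefP A (fun v => ∃ x, P v x) := by
  obtain ⟨φ, hφ⟩ := hP.definable
  -- Entry 0 becomes the bound variable, and the remaining free variables move down by one.
  let g : ℕ → ℕ ⊕ Fin 1 := fun n => Nat.casesOn n (Sum.inr 0) (fun m => Sum.inl m)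
  let ψ : (FirstOrder.Language.withConstants MemLanguage A).BoundedFormula ℕ 1 :=
    FirstOrder.Language.BoundedFormula.relabel (n := 1) (k := 0) g φ
  refine ⟨ψ.ex, ?_⟩
  ext v
  have key : ∀ x, P v x ↔ φ.Realize (vcons x v) := fun x => by
    have := Set.ext_iff.1 hφ (vcons x v)
    simpa using this
  simp only [Set.mem_ofPred_eq, key]
  rw [FirstOrder.Language.Formula.Realize, FirstOrder.Language.BoundedFormula.realize_ex]
  refine exists_congr fun x => ?_
  rw [FirstOrder.Language.BoundedFormula.realize_relabel, FirstOrder.Language.Formula.Realize]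
  have e : vcons x v = Sum.elim v (Fin.snoc default x ∘ Fin.castAdd 0) ∘ g := by
    funext n; cases n with
    | zero => simp [g]; rfl
    | succ n => simp [g]; rfl
  rw [← e]
  exact iff_of_eq (congrArg _ (Subsingleton.elim _ _))

instance DefP.all {P : (ℕ → M) → M → Prop} [hP : DefP A (fun w => P (tl w) (w 0))] :
    DefP A (fun v => ∀ x, P v x) :=
  DefP.of_iff (P := fun v => ¬ ∃ x, ¬ P v x) inferInstance fun v => by push Not; rfl

theorem DefP.mem_var (i j : ℕ) : DefP A (fun v => v i ∈ₘ v j) := by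
  refine ⟨Set.Definable.mono (A := ∅) (Set.empty_definable_iff.2 ?_) (Set.empty_subset _)⟩
  refine ⟨FirstOrder.Language.Relations.formula₂ (L := MemLanguage) MemSymbol.mem
    (FirstOrder.Language.Term.var i) (FirstOrder.Language.Term.var j), ?_⟩
  ext v
  refine Iff.trans ?_ (FirstOrder.Language.Formula.realize_rel₂ (L := MemLanguage)
    (R := MemSymbol.mem)).symm
  rfl

theorem DefP.eq_var (i j : ℕ) : DefP A (fun v : ℕ → M => v i = v j) := by
  refine ⟨(FirstOrder.Language.Term.var i).equal (FirstOrder.Language.Term.var j), ?_⟩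
  ext v
  simp [FirstOrder.Language.Formula.realize_equal]

theorem DefP.eq_const (i : ℕ) (a : M) (ha : a ∈ A) : DefP A (fun v : ℕ → M => v i = a) := by
  refine ⟨(FirstOrder.Language.Term.var i).equal
    (FirstOrder.Language.Constants.term (MemLanguage.con (⟨a, ha⟩ : A))), ?_⟩
  ext v
  simp [FirstOrder.Language.Formula.realize_equal]

/-- The language has no function symbols, so the value of `t` is introduced by an existential
quantifier over its graph. -/
theorem DefP.subst {P : (ℕ → M) → M → Prop} {t : (ℕ → M) → M}
    (hP : DefP A (fun w => P (tl w) (w 0))) [ht : DefT A t] : DefP A (fun v => P v (t v)) := by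
  have := ht.graph
  refine DefP.of_iff (P := fun v => ∃ x, x = t v ∧ P v x) inferInstance fun v => by simp

theorem DefP.weaken {P : (ℕ → M) → Prop} (hP : DefP A P) : DefP A (fun w => P (tl w)) :=
  hP.rename (fun n => n + 1)

theorem DefT.rename {t : (ℕ → M) → M} (ht : DefT A t) (ρ : ℕ → ℕ) :
    DefT A (fun v => t (fun n => v (ρ n))) := by
  refine ⟨(ht.graph.rename (fun n => Nat.casesOn n 0 (fun m => ρ m + 1))).of_iff fun v => ?_⟩
  rfl

theorem DefT.weaken {t : (ℕ → M) → M} (ht : DefT A t) : DefT A (fun w => t (tl w)) :=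
  ht.rename (fun n => n + 1)

theorem DefT.mono {B : Set M} {t : (ℕ → M) → M} (ht : DefT A t) (h : A ⊆ B) : DefT B t :=
  ⟨ht.graph.mono h⟩

/-- Under nested quantifiers an outer variable appears behind several applications of `tl`; any such
shift is still a variable. -/
instance DefT.var (s : (ℕ → M) → (ℕ → M)) [h : IsShift s] (i : ℕ) : DefT A (fun v => s v i) := by
  obtain ⟨k, hk⟩ := h
  refine ⟨(DefP.eq_var 0 (i + k + 1)).of_iff fun v => ?_⟩
  rw [hk]; rfl

instance DefT.const (a : M) [ha : Fact (a ∈ A)] : DefT A (fun _ => a) :=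
  ⟨DefP.eq_const 0 a ha.1⟩

instance DefP.mem (t₁ t₂ : (ℕ → M) → M) [h₁ : DefT A t₁] [h₂ : DefT A t₂] :
    DefP A (fun v => t₁ v ∈ₘ t₂ v) := by
  refine DefP.subst (t := t₁) (P := fun v x => x ∈ₘ t₂ v) ?_
  have := h₂.weaken
  exact DefP.subst (t := fun w => t₂ (tl w)) (P := fun v x => v 0 ∈ₘ x) (DefP.mem_var 1 0)

instance DefP.eq (t₁ t₂ : (ℕ → M) → M) [h₁ : DefT A t₁] [h₂ : DefT A t₂] :
    DefP A (fun v => t₁ v = t₂ v) := by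
  refine DefP.subst (t := t₁) (P := fun v x => x = t₂ v) ?_
  exact h₂.graph

/-- Composition of a definable binary relation with definable functions. -/
theorem DefP.comp₂ {P : M → M → Prop} (hP : DefP A (fun v => P (v 1) (v 0)))
    (t₁ t₂ : (ℕ → M) → M) [h₁ : DefT A t₁] [h₂ : DefT A t₂] : DefP A (fun v => P (t₁ v) (t₂ v)) := by
  refine DefP.subst (t := t₁) (P := fun v x => P x (t₂ v)) ?_
  have := h₂.weaken
  exact DefP.subst (t := fun w => t₂ (tl w)) (P := fun v x => P (v 0) x) hP

theorem DefP.comp₁ {P : M → Prop} (hP : DefP A (fun v => P (v 0)))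
    (t₁ : (ℕ → M) → M) [h₁ : DefT A t₁] : DefP A (fun v => P (t₁ v)) :=
  DefP.subst (t := t₁) (P := fun _ x => P x) hP

theorem DefP.comp₃ {P : M → M → M → Prop} (hP : DefP A (fun v => P (v 2) (v 1) (v 0)))
    (t₁ t₂ t₃ : (ℕ → M) → M) [h₁ : DefT A t₁] [h₂ : DefT A t₂] [h₃ : DefT A t₃] :
    DefP A (fun v => P (t₁ v) (t₂ v) (t₃ v)) := by
  refine DefP.subst (t := t₁) (P := fun v x => P x (t₂ v) (t₃ v)) ?_
  have := h₂.weaken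
  have h₃' := h₃.weaken
  have := h₃'.weaken
  refine DefP.subst (t := fun w => t₂ (tl w)) (P := fun v x => P (v 0) x (t₃ (tl v))) ?_
  exact DefP.subst (t := fun w => t₃ (tl (tl w))) (P := fun v x => P (v 1) (v 0) x) hP

/-- Composition of a definable unary function with a definable function. -/
theorem DefT.comp₁ {f : M → M} (hf : DefP A (fun v => v 1 = f (v 0)))
    (t₁ : (ℕ → M) → M) [h₁ : DefT A t₁] : DefT A (fun v => f (t₁ v)) := by
  have := h₁.weaken
  exact ⟨DefP.comp₂ (P := fun x y => x = f y) hf (fun w => w 0) (fun w => t₁ (tl w))⟩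

/-- Composition of a definable binary function with definable functions. -/
theorem DefT.comp₂ {f : M → M → M} (hf : DefP A (fun v => v 2 = f (v 1) (v 0)))
    (t₁ t₂ : (ℕ → M) → M) [h₁ : DefT A t₁] [h₂ : DefT A t₂] : DefT A (fun v => f (t₁ v) (t₂ v)) := by
  have := h₁.weaken
  have := h₂.weaken
  exact ⟨DefP.comp₃ (P := fun x y z => x = f y z) hf (fun w => w 0) (fun w => t₁ (tl w))
    (fun w => t₂ (tl w))⟩

instance DefP.isUnorderedPair (t₁ t₂ t₃ : (ℕ → M) → M) [DefT A t₁] [DefT A t₂] [DefT A t₃] :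
    DefP A (fun v => IsUnorderedPair (t₁ v) (t₂ v) (t₃ v)) :=
  DefP.comp₃ (by unfold IsUnorderedPair; infer_instance) t₁ t₂ t₃

instance DefP.isPair (t₁ t₂ t₃ : (ℕ → M) → M) [DefT A t₁] [DefT A t₂] [DefT A t₃] :
    DefP A (fun v => IsPair (t₁ v) (t₂ v) (t₃ v)) :=
  DefP.comp₃ (by unfold IsPair; infer_instance) t₁ t₂ t₃

instance DefP.pairMem (t₁ t₂ t₃ : (ℕ → M) → M) [DefT A t₁] [DefT A t₂] [DefT A t₃] :
    DefP A (fun v => PairMem (t₁ v) (t₂ v) (t₃ v)) :=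
  DefP.comp₃ (by unfold PairMem; infer_instance) t₁ t₂ t₃

end Definability

/-! ## Elementary set theory in a universe -/

section ZF

theorem Set.Definable₁.of_defP {M : Type*} [SetUniverse M] {A : Set M} (P : M → Prop)
    [h : DefP A (fun v => P (v 0))] : Set.Definable₁ A MemLanguage {x | P x} :=
  h.definable.preimage_comp (fun _ => (0 : Fin 1))

variable {M : Type*} [SetUniverse M]

instance (a : M) : Fact (a ∈ (Set.univ : Set M)) := ⟨trivial⟩

theorem DefP.univ {A : Set M} {P : (ℕ → M) → Prop} (h : DefP A P) : DefP Set.univ P :=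
  h.mono (Set.subset_univ _)

theorem DefT.univ {A : Set M} {t : (ℕ → M) → M} (h : DefT A t) : DefT Set.univ t :=
  h.mono (Set.subset_univ _)

theorem SetUniverse.IsUnorderedPair.inj {p a b c d : M} (h : IsUnorderedPair p a b)
    (h' : IsUnorderedPair p c d) : a = c ∧ b = d ∨ a = d ∧ b = c := by
  have h₁ := (h a).symm.trans (h' a)
  have h₂ := (h b).symm.trans (h' b)
  have h₃ := (h c).symm.trans (h' c)
  have h₄ := (h d).symm.trans (h' d)
  grind

variable [hZ : Fact (IsZF M)]

namespace SetUniverse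

theorem ext {a b : M} (h : ∀ z, z ∈ₘ a ↔ z ∈ₘ b) : a = b := hZ.1.extensionality a b h

theorem exists_sep (P : M → Prop) [DefP Set.univ (fun v => P (v 0))] (a : M) :
    ∃ b, ∀ x, x ∈ₘ b ↔ x ∈ₘ a ∧ P x :=
  hZ.1.separation _ (Set.Definable₁.of_defP P) a

theorem IsUnorderedPair.unique {p q a b : M} (h : IsUnorderedPair p a b)
    (h' : IsUnorderedPair q a b) : p = q := ext fun z => (h z).trans (h' z).symm

theorem isPair_iff {p a b s d : M} (hs : IsUnorderedPair s a a) (hd : IsUnorderedPair d a b) :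
    IsPair p a b ↔ IsUnorderedPair p s d := by
  refine forall_congr' fun z => iff_congr Iff.rfl (or_congr ?_ ?_)
  · exact ⟨fun h => h.unique hs, fun h => h ▸ hs⟩
  · exact ⟨fun h => h.unique hd, fun h => h ▸ hd⟩

theorem exists_isPair (a b : M) : ∃ p, IsPair p a b := by
  obtain ⟨s, hs⟩ := hZ.1.pairing a a
  obtain ⟨d, hd⟩ := hZ.1.pairing a b
  obtain ⟨p, hp⟩ := hZ.1.pairing s d
  exact ⟨p, (isPair_iff hs hd).2 hp⟩

theorem IsPair.inj {p a b c d : M} (h : IsPair p a b) (h' : IsPair p c d) : a = c ∧ b = d := by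
  obtain ⟨s, hs⟩ := hZ.1.pairing a a
  obtain ⟨t, ht⟩ := hZ.1.pairing a b
  obtain ⟨s', hs'⟩ := hZ.1.pairing c c
  obtain ⟨t', ht'⟩ := hZ.1.pairing c d
  rcases ((isPair_iff hs ht).1 h).inj ((isPair_iff hs' ht').1 h') with ⟨rfl, rfl⟩ | ⟨rfl, rfl⟩
  · have h₁ := hs.inj hs'
    have h₂ := ht.inj ht'
    grind
  · have h₁ := hs.inj ht'
    have h₂ := ht.inj hs'
    grind

/-- The ordered pair of `a` and `b`. -/
noncomputable def opair (a b : M) : M := (exists_isPair a b).choose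

theorem isPair_opair (a b : M) : IsPair (opair a b) a b := (exists_isPair a b).choose_spec

theorem isPair_iff_eq {p a b : M} : IsPair p a b ↔ p = opair a b := by
  refine ⟨fun h => ?_, fun h => h ▸ isPair_opair a b⟩
  exact ext fun z => (h z).trans (isPair_opair a b z).symm

theorem opair_inj {a b c d : M} : opair a b = opair c d ↔ a = c ∧ b = d := by
  refine ⟨fun h => (isPair_opair a b).inj (h ▸ isPair_opair c d), ?_⟩
  rintro ⟨rfl, rfl⟩; rfl

theorem pairMem_iff {r a b : M} : PairMem r a b ↔ opair a b ∈ₘ r := by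
  simp [PairMem, isPair_iff_eq]

instance _root_.DefT.opair {A : Set M} (t₁ t₂ : (ℕ → M) → M) [DefT A t₁] [DefT A t₂] :
    DefT A (fun v => opair (t₁ v) (t₂ v)) := by
  refine DefT.comp₂ (f := SetUniverse.opair) ?_ t₁ t₂
  simp only [← isPair_iff_eq]
  infer_instance

/-- A set which contains all pairs of elements of `a` and elements of `b`. -/
theorem exists_prod (a b : M) : ∃ c, ∀ x y, x ∈ₘ a → y ∈ₘ b → opair x y ∈ₘ c := by
  obtain ⟨p, hp⟩ := hZ.1.pairing a b
  obtain ⟨u, hu⟩ := hZ.1.union p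
  obtain ⟨q, hq⟩ := hZ.1.power u
  obtain ⟨r, hr⟩ := hZ.1.power q
  refine ⟨r, fun x y hx hy => (hr _).2 fun z hz => (hq z).2 fun w hw => (hu w).2 ?_⟩
  have : w = x ∨ w = y := by
    rcases (isPair_opair x y z).1 hz with h | h
    · have := (h w).1 hw; tauto
    · exact (h w).1 hw
  rcases this with rfl | rfl
  · exact ⟨a, (hp a).2 (Or.inl rfl), hx⟩
  · exact ⟨b, (hp b).2 (Or.inr rfl), hy⟩

/-- A definable relation between the elements of two sets is a set. -/
theorem exists_rel (P : M → M → Prop) [DefP Set.univ (fun v => P (v 1) (v 0))] (a b : M) :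
    ∃ S, ∀ p, p ∈ₘ S ↔ ∃ x y, x ∈ₘ a ∧ y ∈ₘ b ∧ P x y ∧ p = opair x y := by
  obtain ⟨c, hc⟩ := exists_prod a b
  have inst : ∀ (t₁ t₂ : (ℕ → M) → M) [DefT Set.univ t₁] [DefT Set.univ t₂],
      DefP Set.univ (fun v => P (t₁ v) (t₂ v)) := fun t₁ t₂ _ _ => DefP.comp₂ inferInstance t₁ t₂
  obtain ⟨S, hS⟩ := exists_sep (fun p => ∃ x y, x ∈ₘ a ∧ y ∈ₘ b ∧ P x y ∧ p = opair x y) c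
  refine ⟨S, fun p => (hS p).trans ⟨And.right, fun h => ⟨?_, h⟩⟩⟩
  obtain ⟨x, y, hx, hy, -, rfl⟩ := h
  exact hc x y hx hy

theorem exists_succ (a : M) : ∃ b, ∀ z, z ∈ₘ b ↔ z ∈ₘ a ∨ z = a := by
  obtain ⟨s, hs⟩ := hZ.1.pairing a a
  obtain ⟨p, hp⟩ := hZ.1.pairing a s
  obtain ⟨u, hu⟩ := hZ.1.union p
  refine ⟨u, fun z => (hu z).trans ⟨?_, ?_⟩⟩
  · rintro ⟨x, hx, hz⟩
    rcases (hp x).1 hx with rfl | rfl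
    · exact Or.inl hz
    · have := (hs z).1 hz; tauto
  · rintro (h | rfl)
    · exact ⟨a, (hp a).2 (Or.inl rfl), h⟩
    · exact ⟨s, (hp s).2 (Or.inr rfl), (hs z).2 (Or.inl rfl)⟩

/-- `a ∪ {a}` -/
noncomputable def succ (a : M) : M := (exists_succ a).choose

theorem mem_succ (a z : M) : z ∈ₘ succ a ↔ z ∈ₘ a ∨ z = a := (exists_succ a).choose_spec z

theorem eq_succ_iff {a b : M} : b = succ a ↔ ∀ z, z ∈ₘ b ↔ z ∈ₘ a ∨ z = a := by
  refine ⟨fun h => h ▸ mem_succ a, fun h => ext fun z => (h z).trans (mem_succ a z).symm⟩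

instance _root_.DefT.succ {A : Set M} (t : (ℕ → M) → M) [DefT A t] :
    DefT A (fun v => succ (t v)) := by
  refine DefT.comp₁ (f := SetUniverse.succ) ?_ t
  simp only [eq_succ_iff]
  infer_instance

/-- Otherwise `a ∈ b` and `b ∈ a`, which contradicts foundation for `{a, b}`. -/
theorem succ_inj {a b : M} (h : succ a = succ b) : a = b := by
  by_contra hne
  have h₁ : a ∈ₘ b := by
    have := (mem_succ b a).1 (h ▸ (mem_succ a a).2 (Or.inr rfl)); tauto
  have h₂ : b ∈ₘ a := by
    have := (mem_succ a b).1 (h ▸ (mem_succ b b).2 (Or.inr rfl))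
    rcases this with h | h
    · exact h
    · exact absurd h.symm hne
  obtain ⟨p, hp⟩ := hZ.1.pairing a b
  obtain ⟨x, hx, hx'⟩ := hZ.1.foundation p ⟨a, (hp a).2 (Or.inl rfl)⟩
  rcases (hp x).1 hx with rfl | rfl
  · exact hx' b h₂ ((hp b).2 (Or.inr rfl))
  · exact hx' a h₁ ((hp a).2 (Or.inl rfl))

theorem exists_empty : ∃ e : M, ∀ z, ¬ z ∈ₘ e := by
  obtain ⟨s, ⟨e, -, he⟩, -⟩ := hZ.1.infinity
  exact ⟨e, he⟩

/-- The empty set. -/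
noncomputable def emptySet (M : Type*) [SetUniverse M] [Fact (IsZF M)] : M :=
  (exists_empty (M := M)).choose

theorem not_mem_emptySet (z : M) : ¬ z ∈ₘ emptySet M := (exists_empty (M := M)).choose_spec z

theorem eq_emptySet {a : M} : a = emptySet M ↔ ∀ z, ¬ z ∈ₘ a :=
  ⟨fun h => h ▸ not_mem_emptySet, fun h => ext fun z =>
    ⟨fun hz => absurd hz (h z), fun hz => absurd hz (not_mem_emptySet z)⟩⟩

theorem succ_ne_emptySet (a : M) : succ a ≠ emptySet M := fun h =>
  eq_emptySet.1 h a ((mem_succ a a).2 (Or.inr rfl))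

instance _root_.DefT.emptySet {A : Set M} : DefT A (fun _ => emptySet M) := by
  refine ⟨?_⟩
  simp only [eq_emptySet]
  infer_instance

theorem isInductive_iff {s : M} :
    IsInductive s ↔ emptySet M ∈ₘ s ∧ ∀ x, x ∈ₘ s → succ x ∈ₘ s := by
  refine and_congr ⟨?_, fun h => ⟨_, h, not_mem_emptySet⟩⟩ (forall₂_congr fun x _ => ⟨?_, ?_⟩)
  · rintro ⟨e, he, h⟩
    rwa [← eq_emptySet.2 h]
  · rintro ⟨t, ht, h⟩
    rwa [← eq_succ_iff.2 h]
  · exact fun h => ⟨_, h, mem_succ x⟩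

instance _root_.DefP.isNatural {A : Set M} (t : (ℕ → M) → M) [DefT A t] :
    DefP A (fun v => IsNatural (t v)) := by
  refine DefP.comp₁ (P := IsNatural) ?_ t
  simp only [IsNatural, isInductive_iff]
  infer_instance

end SetUniverse
end ZF

/-! ## Standard sets -/

section Spot

variable {M : Type*} [SetUniverse M]

/-- The set of standard sets, as a set of parameters. -/
abbrev Standards (M : Type*) [SetUniverse M] : Set M := {x | std x}

/-- Makes a standard set available as a parameter in the instance search for definability. -/
theorem Fact.std {x : M} (h : std x) : Fact (x ∈ Standards M) := ⟨h⟩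

variable [hS : Fact (IsSPOT M)]

instance : Fact (IsZF M) := ⟨hS.1.toIsZF⟩

namespace SetUniverse

theorem transfer (P : M → Prop) [DefP (Standards M) (fun v => P (v 0))]
    (h : ∀ x, std x → P x) (x : M) : P x :=
  hS.1.transfer _ (Set.Definable₁.of_defP P) h x

theorem exists_std (P : M → Prop) [DefP (Standards M) (fun v => P (v 0))]
    (h : ∃ x, P x) : ∃ x, std x ∧ P x := by
  by_contra! h'
  obtain ⟨x, hx⟩ := h
  exact transfer (fun x => ¬ P x) h' x hx

/-- By Transfer the condition that defines `a` has a standard solution, and `a` is its only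
solution. -/
theorem std_of_def (a : M) [h : DefT (Standards M) (fun _ => a)] : std a := by
  have := h.graph
  obtain ⟨x, hx, rfl⟩ := exists_std (fun x => x = a) ⟨a, rfl⟩
  exact hx

/-- A standard subset of a standard set with a given definition. -/
theorem exists_std_sep (P : M → Prop) [hP : DefP (Standards M) (fun v => P (v 0))] (a : M)
    (ha : std a) : ∃ b, std b ∧ ∀ x, x ∈ₘ b ↔ x ∈ₘ a ∧ P x := by
  have := Fact.std ha
  have inst : ∀ (t : (ℕ → M) → M) [DefT (Standards M) t],
      DefP (Standards M) (fun v => P (t v)) := fun t _ => DefP.comp₁ inferInstance t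
  have := hP.univ
  exact exists_std (fun b => ∀ x, x ∈ₘ b ↔ x ∈ₘ a ∧ P x) (exists_sep P a)

end SetUniverse
end Spot

/-! ## Definability of the operations on real numbers -/

namespace RealLine

section Definability

variable {M : Type*} [SetUniverse M]

/-- The parameters in the definition of the ordered field of reals belong to `A`. -/
class Params (A : Set M) (R : RealLine M) : Prop where
  carrier : R.carrier ∈ A
  addGraph : R.addGraph ∈ A
  mulGraph : R.mulGraph ∈ A
  ltGraph : R.ltGraph ∈ A

instance (R : RealLine M) : Params Set.univ R := ⟨trivial, trivial, trivial, trivial⟩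

instance (R : RealLine M) : Params (Standards M) R :=
  ⟨R.std_carrier, R.std_addGraph, R.std_mulGraph, R.std_ltGraph⟩

open Classical in
/-- The set `m` as a real number, with the junk value `0` if `m` is not a real number. -/
noncomputable def toPt (R : RealLine M) (m : M) : R.Pt :=
  if h : m ∈ₘ R.carrier then ⟨m, h⟩ else 0

@[simp] theorem toPt_val {R : RealLine M} (x : R.Pt) : R.toPt x.1 = x := by simp [toPt, x.2]

theorem val_toPt {R : RealLine M} {m : M} (h : m ∈ₘ R.carrier) : (R.toPt m).1 = m := by
  simp [toPt, h]

variable {A : Set M} {R : RealLine M}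

instance [h : Params A R] : Fact (R.carrier ∈ A) := ⟨h.1⟩
instance [h : Params A R] : Fact (R.addGraph ∈ A) := ⟨h.2⟩
instance [h : Params A R] : Fact (R.mulGraph ∈ A) := ⟨h.3⟩
instance [h : Params A R] : Fact (R.ltGraph ∈ A) := ⟨h.4⟩

theorem _root_.DefT.weakenPt {t : (ℕ → M) → R.Pt} (h : DefT A (fun v => (t v).1)) :
    DefT A (fun w => (t (tl w)).1) := h.weaken

/-- A real-valued function with a definable characterization of its values is definable. -/
theorem _root_.DefT.of_iff [Params A R] {t : (ℕ → M) → R.Pt} {P : (ℕ → M) → R.Pt → Prop}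
    (hP : DefP A (fun w => P (tl w) (R.toPt (w 0)))) (h : ∀ v x, x = t v ↔ P v x) :
    DefT A (fun v => (t v).1) := by
  refine ⟨DefP.of_iff (P := fun w => w 0 ∈ₘ R.carrier ∧ P (tl w) (R.toPt (w 0))) inferInstance
    fun w => ?_⟩
  rw [← h]
  constructor
  · intro e; rw [e]; exact ⟨(t _).2, toPt_val _⟩
  · rintro ⟨h₁, h₂⟩
    rw [← h₂, val_toPt h₁]

variable [hZ : Fact (IsZF M)] [hR : Params A R]

theorem add_graph_iff {x y z : R.Pt} :
    opair (opair x.1 y.1) z.1 ∈ₘ R.addGraph ↔ z = x + y := by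
  simp only [R.mem_addGraph, isPair_iff_eq, opair_inj]
  constructor
  · rintro ⟨x', y', q, rfl, h, h'⟩
    rw [opair_inj] at h
    obtain ⟨h₁, h₂⟩ := h
    rw [Subtype.ext h₁, Subtype.ext h₂]
    exact Subtype.ext h'
  · rintro rfl
    exact ⟨x, y, _, rfl, rfl, rfl⟩

theorem mul_graph_iff {x y z : R.Pt} :
    opair (opair x.1 y.1) z.1 ∈ₘ R.mulGraph ↔ z = x * y := by
  simp only [R.mem_mulGraph, isPair_iff_eq, opair_inj]
  constructor
  · rintro ⟨x', y', q, rfl, h, h'⟩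
    rw [opair_inj] at h
    obtain ⟨h₁, h₂⟩ := h
    rw [Subtype.ext h₁, Subtype.ext h₂]
    exact Subtype.ext h'
  · rintro rfl
    exact ⟨x, y, _, rfl, rfl, rfl⟩

theorem lt_graph_iff {x y : R.Pt} : opair x.1 y.1 ∈ₘ R.ltGraph ↔ x < y := by
  simp only [R.mem_ltGraph, isPair_iff_eq, opair_inj]
  constructor
  · rintro ⟨x', y', h, h₁, h₂⟩
    rwa [Subtype.ext h₁, Subtype.ext h₂]
  · intro h
    exact ⟨x, y, h, rfl, rfl⟩

theorem mem_of_add_graph {x y z : M} (h : opair (opair x y) z ∈ₘ R.addGraph) :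
    z ∈ₘ R.carrier := by
  obtain ⟨x', y', q, -, h⟩ := (R.mem_addGraph _).1 h
  rw [isPair_iff_eq, opair_inj] at h
  rw [h.2]; exact (x' + y').2

theorem mem_of_mul_graph {x y z : M} (h : opair (opair x y) z ∈ₘ R.mulGraph) :
    z ∈ₘ R.carrier := by
  obtain ⟨x', y', q, -, h⟩ := (R.mem_mulGraph _).1 h
  rw [isPair_iff_eq, opair_inj] at h
  rw [h.2]; exact (x' * y').2

/-- Zero is the only solution of `x + x = x`. -/
instance _root_.DefT.zeroPt : DefT A (fun _ => (0 : R.Pt).1) := by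
  refine ⟨DefP.of_iff (P := fun w => opair (opair (w 0) (w 0)) (w 0) ∈ₘ R.addGraph)
    (by infer_instance) fun w => ⟨fun h => ?_, fun h => ?_⟩⟩
  · rw [h, add_graph_iff]; simp
  · have := mem_of_add_graph h
    rw [← val_toPt this] at h ⊢
    rw [add_graph_iff] at h
    congr 1
    simpa using h

/-- One is the only nonzero solution of `x * x = x`. -/
instance _root_.DefT.onePt : DefT A (fun _ => (1 : R.Pt).1) := by
  refine ⟨DefP.of_iff (P := fun w => opair (opair (w 0) (w 0)) (w 0) ∈ₘ R.mulGraph ∧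
    w 0 ≠ (0 : R.Pt).1) (by infer_instance) fun w => ⟨fun h => ?_, fun ⟨h, h'⟩ => ?_⟩⟩
  · rw [h, mul_graph_iff]; simp
    exact fun h => one_ne_zero (Subtype.ext h)
  · have := mem_of_mul_graph h
    rw [← val_toPt this] at h h' ⊢
    rw [mul_graph_iff] at h
    congr 1
    have h'' : R.toPt (w 0) ≠ 0 := fun e => h' (by rw [e])
    exact (mul_eq_left₀ h'').1 h.symm

instance _root_.DefT.ite (p : (ℕ → M) → Prop) [i : ∀ v, Decidable (p v)] (t₁ t₂ : (ℕ → M) → M)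
    [hp : DefP A p] [h₁ : DefT A t₁] [h₂ : DefT A t₂] :
    DefT A (fun v => if p v then t₁ v else t₂ v) := by
  have := hp.weaken
  have := h₁.weaken
  have := h₂.weaken
  refine ⟨DefP.of_iff (P := fun w => p (tl w) ∧ w 0 = t₁ (tl w) ∨ ¬ p (tl w) ∧ w 0 = t₂ (tl w))
    inferInstance fun w => ?_⟩
  by_cases h : p (tl w) <;> simp [h]

instance _root_.DefT.itePt (p : (ℕ → M) → Prop) [i : ∀ v, Decidable (p v)]
    (t₁ t₂ : (ℕ → M) → R.Pt) [hp : DefP A p] [h₁ : DefT A (fun v => (t₁ v).1)]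
    [h₂ : DefT A (fun v => (t₂ v).1)] :
    DefT A (fun v => (if p v then t₁ v else t₂ v : R.Pt).1) := by
  simp only [apply_ite Subtype.val]
  infer_instance

theorem _root_.DefT.comp_toPt (t : (ℕ → M) → M) [DefT A t] : DefT A (fun v => (R.toPt (t v)).1) := by
  classical
  have : (fun v => (R.toPt (t v)).1) = fun v => if t v ∈ₘ R.carrier then t v else (0 : R.Pt).1 := by
    funext v
    by_cases h : t v ∈ₘ R.carrier <;> simp [toPt, h]
  rw [this]
  infer_instance

instance _root_.DefT.toPt (t : (ℕ → M) → M) [DefT A t] : DefT A (fun v => (R.toPt (t v)).1) :=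
  DefT.comp_toPt t

/-- A quantifier over reals is a quantifier over sets bounded by the carrier; the junk value of
`toPt` is itself a real and does no harm. -/
instance _root_.DefP.exPt {P : (ℕ → M) → R.Pt → Prop}
    [hP : DefP A (fun w => P (tl w) (R.toPt (w 0)))] : DefP A (fun v => ∃ x, P v x) := by
  refine DefP.of_iff (P := fun v => ∃ m, m ∈ₘ R.carrier ∧ P v (R.toPt m)) inferInstance fun v =>
    ⟨fun ⟨x, hx⟩ => ⟨x.1, x.2, by simpa⟩, fun ⟨m, _, hm⟩ => ⟨_, hm⟩⟩

instance _root_.DefP.allPt {P : (ℕ → M) → R.Pt → Prop}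
    [hP : DefP A (fun w => P (tl w) (R.toPt (w 0)))] : DefP A (fun v => ∀ x, P v x) :=
  DefP.of_iff (P := fun v => ¬ ∃ x, ¬ P v x) inferInstance fun v => by push Not; rfl

instance _root_.DefP.eqPt (t₁ t₂ : (ℕ → M) → R.Pt) [DefT A (fun v => (t₁ v).1)]
    [DefT A (fun v => (t₂ v).1)] : DefP A (fun v => t₁ v = t₂ v) := by
  simp only [Subtype.ext_iff]; infer_instance

instance _root_.DefP.ltPt (t₁ t₂ : (ℕ → M) → R.Pt) [DefT A (fun v => (t₁ v).1)]
    [DefT A (fun v => (t₂ v).1)] : DefP A (fun v => t₁ v < t₂ v) := by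
  simp only [← lt_graph_iff]; infer_instance

instance _root_.DefP.lePt (t₁ t₂ : (ℕ → M) → R.Pt) [DefT A (fun v => (t₁ v).1)]
    [DefT A (fun v => (t₂ v).1)] : DefP A (fun v => t₁ v ≤ t₂ v) := by
  simp only [← not_lt]; infer_instance

section Operations

variable (t t₁ t₂ : (ℕ → M) → R.Pt) [h : DefT A (fun v => (t v).1)]
  [h₁ : DefT A (fun v => (t₁ v).1)] [h₂ : DefT A (fun v => (t₂ v).1)]

instance _root_.DefT.addPt : DefT A (fun v => (t₁ v + t₂ v : R.Pt).1) := by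
  have := h₁.weakenPt
  have := h₂.weakenPt
  exact DefT.of_iff (P := fun v x => opair (opair (t₁ v).1 (t₂ v).1) x.1 ∈ₘ R.addGraph)
    inferInstance fun v x => add_graph_iff.symm

instance _root_.DefT.mulPt : DefT A (fun v => (t₁ v * t₂ v : R.Pt).1) := by
  have := h₁.weakenPt
  have := h₂.weakenPt
  exact DefT.of_iff (P := fun v x => opair (opair (t₁ v).1 (t₂ v).1) x.1 ∈ₘ R.mulGraph)
    inferInstance fun v x => mul_graph_iff.symm

instance _root_.DefT.subPt : DefT A (fun v => (t₁ v - t₂ v : R.Pt).1) := by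
  have := h₁.weakenPt
  have := h₂.weakenPt
  exact DefT.of_iff (P := fun v x => x + t₂ v = t₁ v) inferInstance fun v x => eq_sub_iff_add_eq

instance _root_.DefT.negPt : DefT A (fun v => (-(t v) : R.Pt).1) := by
  simp only [← zero_sub]; infer_instance

instance _root_.DefT.invPt : DefT A (fun v => ((t v)⁻¹ : R.Pt).1) := by
  have := h.weakenPt
  -- The first alternative covers the convention `0⁻¹ = 0`.
  refine DefT.of_iff (P := fun v x => (t v = 0 ∧ x = 0) ∨ x * t v = 1) inferInstance fun v x => ?_
  by_cases hv : t v = 0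
  · simp [hv]
  · simp [hv, mul_eq_one_iff_eq_inv₀ hv]

instance _root_.DefT.divPt : DefT A (fun v => (t₁ v / t₂ v : R.Pt).1) := by
  simp only [div_eq_mul_inv]; infer_instance

instance _root_.DefT.powPt (n : ℕ) : DefT A (fun v => (t v ^ n : R.Pt).1) := by
  induction n with
  | zero => simp only [pow_zero]; infer_instance
  | succ n ih => simp only [pow_succ]; infer_instance

instance _root_.DefT.maxPt : DefT A (fun v => (max (t₁ v) (t₂ v) : R.Pt).1) := by
  simp only [max_def]; infer_instance

instance _root_.DefT.minPt : DefT A (fun v => (min (t₁ v) (t₂ v) : R.Pt).1) := by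
  simp only [min_def]; infer_instance

instance _root_.DefT.absPt : DefT A (fun v => (|t v| : R.Pt).1) := by
  simp only [abs]; infer_instance

end Operations

instance _root_.DefT.natCastPt (n : ℕ) : DefT A (fun _ => (n : R.Pt).1) := by
  induction n with
  | zero => simp only [Nat.cast_zero]; infer_instance
  | succ n ih => simp only [Nat.cast_succ]; infer_instance

instance _root_.DefT.ofNatPt (n : ℕ) [n.AtLeastTwo] : DefT A (fun _ => (OfNat.ofNat n : R.Pt).1) :=
  DefT.natCastPt n

instance _root_.DefP.naturals (t : (ℕ → M) → R.Pt) [DefT A (fun v => (t v).1)] :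
    DefP A (fun v => t v ∈ R.naturals) := by
  have := DefP.comp₁ (A := A) (P := fun m => R.toPt m ∈ RealLine.naturals R)
    (by simp only [RealLine.naturals, Set.mem_ofPred_eq]; infer_instance) (fun v => (t v).1)
  simpa using this

end Definability

end RealLine

/-! ## Definable functions of real numbers -/

namespace RealLine

section Functions

variable {M : Type*} [SetUniverse M] {A : Set M} {R : RealLine M}

/-- The function `f` is definable with parameters from `A`. -/
class DefF (A : Set M) (f : R.Pt → R.Pt) : Prop where
  graph : DefP A (fun v => v 1 = (f (R.toPt (v 0))).1)

/-- The function `f` of two variables is definable with parameters from `A`. -/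
class DefF₂ (A : Set M) (f : R.Pt → R.Pt → R.Pt) : Prop where
  graph : DefP A (fun v => v 2 = (f (R.toPt (v 1)) (R.toPt (v 0))).1)

instance (priority := low) DefF.comp (f : R.Pt → R.Pt)
    (t : (ℕ → M) → R.Pt) [hf : DefF A f] [ht : DefT A (fun v => (t v).1)] :
    DefT A (fun v => (f (t v)).1) := by
  have := DefT.comp₁ (f := fun m => (f (R.toPt m)).1) hf.graph (fun v => (t v).1)
  simpa using this

instance (priority := low) DefF₂.comp (f : R.Pt → R.Pt → R.Pt)
    (t₁ t₂ : (ℕ → M) → R.Pt) [hf : DefF₂ A f] [h₁ : DefT A (fun v => (t₁ v).1)]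
    [h₂ : DefT A (fun v => (t₂ v).1)] : DefT A (fun v => (f (t₁ v) (t₂ v)).1) := by
  have := DefT.comp₂ (f := fun m n => (f (R.toPt m) (R.toPt n)).1) hf.graph (fun v => (t₁ v).1)
    (fun v => (t₂ v).1)
  simpa using this

theorem DefF.univ {f : R.Pt → R.Pt} (h : DefF A f) : DefF Set.univ f := ⟨h.graph.univ⟩

theorem DefF₂.univ {f : R.Pt → R.Pt → R.Pt} (h : DefF₂ A f) : DefF₂ Set.univ f := ⟨h.graph.univ⟩

theorem DefP.compPt {P : R.Pt → Prop} (hP : DefP A (fun v => P (R.toPt (v 0))))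
    (t : (ℕ → M) → R.Pt) [h : DefT A (fun v => (t v).1)] : DefP A (fun v => P (t v)) := by
  have := DefP.comp₁ (P := fun m => P (R.toPt m)) hP (fun v => (t v).1)
  simpa using this

end Functions

/-! ## Induction and completeness -/

section Analysis

variable {M : Type*} [SetUniverse M] {R : RealLine M}

theorem zero_mem_naturals : (0 : R.Pt) ∈ R.naturals := fun _ h _ => h

theorem add_one_mem_naturals {n : R.Pt} (hn : n ∈ R.naturals) : n + 1 ∈ R.naturals :=
  fun s h₀ h₁ => h₁ n (hn s h₀ h₁)

theorem HasDerivOn.sub_mul {D : Set R.Pt} {f : R.Pt → R.Pt} {d x : R.Pt}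
    (h : HasDerivOn D f d x) (m : R.Pt) : HasDerivOn D (fun z => f z - m * z) (d - m) x := by
  intro η hη
  obtain ⟨δ, hδ, h⟩ := h η hη
  refine ⟨δ, hδ, fun z hz hzx => ?_⟩
  convert h z hz hzx using 2
  ring

theorem HasDerivOn.mul_sub {D : Set R.Pt} {f : R.Pt → R.Pt} {d x : R.Pt}
    (h : HasDerivOn D f d x) (m : R.Pt) : HasDerivOn D (fun z => m * z - f z) (m - d) x := by
  intro η hη
  obtain ⟨δ, hδ, h⟩ := h η hη
  refine ⟨δ, hδ, fun z hz hzx => ?_⟩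
  rw [← abs_neg]
  convert h z hz hzx using 2
  ring

theorem one_mem_naturals : (1 : R.Pt) ∈ R.naturals := by
  simpa using add_one_mem_naturals (zero_mem_naturals (R := R))

variable [hZ : Fact (IsZF M)]

theorem naturals_induction (P : R.Pt → Prop) [DefP Set.univ (fun v => P (R.toPt (v 0)))]
    (h₀ : P 0) (h₁ : ∀ n ∈ R.naturals, P n → P (n + 1)) {n : R.Pt} (hn : n ∈ R.naturals) :
    P n := by
  obtain ⟨s, hs⟩ := exists_sep (fun m => P (R.toPt m) ∧ R.toPt m ∈ R.naturals) R.carrier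
  have := hn s ((hs _).2 ⟨(0 : R.Pt).2, by simpa using ⟨h₀, zero_mem_naturals⟩⟩) fun x hx => by
    have := ((hs _).1 hx).2
    rw [toPt_val] at this
    exact (hs _).2 ⟨(x + 1).2, by
      rw [toPt_val]; exact ⟨h₁ x this.2 this.1, add_one_mem_naturals this.2⟩⟩
  simpa using ((hs _).1 this).2.1

theorem nonneg_of_mem_naturals {n : R.Pt} (hn : n ∈ R.naturals) : 0 ≤ n :=
  naturals_induction (fun n => 0 ≤ n) le_rfl (fun n _ h => by linarith) hn

theorem add_mem_naturals {m n : R.Pt} (hm : m ∈ R.naturals) (hn : n ∈ R.naturals) :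
    m + n ∈ R.naturals :=
  naturals_induction (fun n => m + n ∈ R.naturals) (by simpa)
    (fun n _ h => by rw [← add_assoc]; exact add_one_mem_naturals h) hn

theorem mul_mem_naturals {m n : R.Pt} (hm : m ∈ R.naturals) (hn : n ∈ R.naturals) :
    m * n ∈ R.naturals :=
  naturals_induction (fun n => m * n ∈ R.naturals) (by simpa using zero_mem_naturals)
    (fun n _ h => by rw [mul_add, mul_one]; exact add_mem_naturals h hm) hn

theorem sub_one_mem_naturals {n : R.Pt} (hn : n ∈ R.naturals) (h : n ≠ 0) :
    n - 1 ∈ R.naturals := by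
  refine naturals_induction (fun n => n ≠ 0 → n - 1 ∈ R.naturals) (by simp) ?_ hn h
  intro n hn _ _
  simpa using hn

theorem one_le_of_mem_naturals {n : R.Pt} (hn : n ∈ R.naturals) (h : n ≠ 0) : 1 ≤ n := by
  have := nonneg_of_mem_naturals (sub_one_mem_naturals hn h)
  linarith

theorem sub_mem_naturals {m n : R.Pt} (hm : m ∈ R.naturals) (hn : n ∈ R.naturals) (h : m ≤ n) :
    n - m ∈ R.naturals := by
  refine naturals_induction (fun m => m ≤ n → n - m ∈ R.naturals) (by simp [hn]) ?_ hm h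
  intro m _ ih h
  have := sub_one_mem_naturals (ih (by linarith)) (by intro h'; linarith)
  rwa [sub_sub] at this

theorem add_one_le_of_lt {m n : R.Pt} (hm : m ∈ R.naturals) (hn : n ∈ R.naturals) (h : m < n) :
    m + 1 ≤ n := by
  have := one_le_of_mem_naturals (sub_mem_naturals hm hn h.le) (by intro h'; linarith)
  linarith

/-- Without a least element, induction on `n` shows that no natural number up to `n` satisfies `P`.
-/
theorem exists_least (P : R.Pt → Prop) [hP : DefP Set.univ (fun v => P (R.toPt (v 0)))]
    {n : R.Pt} (hn : n ∈ R.naturals) (h : P n) :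
    ∃ m ∈ R.naturals, P m ∧ ∀ k ∈ R.naturals, k < m → ¬ P k := by
  by_contra! h'
  have inst := DefP.compPt hP
  refine naturals_induction (fun n => ∀ m ∈ R.naturals, m ≤ n → ¬ P m) ?_ ?_ hn n hn le_rfl h
  · intro m hm hm0 hP
    obtain ⟨k, hk, hk', -⟩ := h' m hm hP
    linarith [nonneg_of_mem_naturals hk]
  · intro n hn ih m hm hmn hP
    obtain ⟨k, hk, hk', hPk⟩ := h' m hm hP
    have := add_one_le_of_lt hk hm hk'
    exact ih k hk (by linarith) hPk

theorem exists_isLUB (P : R.Pt → Prop) [DefP Set.univ (fun v => P (R.toPt (v 0)))]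
    (hne : ∃ x, P x) (b : R.Pt) (hb : ∀ x, P x → x ≤ b) : ∃ s, IsLUB {x | P x} s := by
  obtain ⟨A, hA⟩ := exists_sep (fun m => P (R.toPt m)) R.carrier
  have hA' : ∀ x : R.Pt, x.1 ∈ₘ A ↔ P x := fun x => by rw [hA, toPt_val]; exact and_iff_right x.2
  obtain ⟨x, hx⟩ := hne
  obtain ⟨s, hs⟩ := R.complete A (fun x hx => ((hA x).1 hx).1) ⟨x.1, (hA' x).2 hx⟩
    ⟨b, fun x hx => hb x ((hA' x).1 hx)⟩
  exact ⟨s, by simpa only [hA'] using hs⟩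

theorem exists_natural_gt (x : R.Pt) : ∃ n ∈ R.naturals, x < n := by
  by_contra! h
  obtain ⟨s, hs⟩ := exists_isLUB (fun n => n ∈ R.naturals) ⟨0, zero_mem_naturals⟩ x h
  have : s ≤ s - 1 := hs.2 fun n hn => by
    have : n + 1 ≤ s := hs.1 (add_one_mem_naturals hn)
    linarith
  linarith

theorem exists_floor {x : R.Pt} (hx : 0 ≤ x) : ∃ n ∈ R.naturals, n ≤ x ∧ x < n + 1 := by
  obtain ⟨n, hn, hxn⟩ := exists_natural_gt x
  obtain ⟨m, hm, hxm, h⟩ := exists_least (fun n => x < n) hn hxn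
  have hm0 : m ≠ 0 := by rintro rfl; linarith
  refine ⟨m - 1, sub_one_mem_naturals hm hm0, ?_, by simpa⟩
  have := h _ (sub_one_mem_naturals hm hm0) (by linarith)
  linarith

/-- Induction along an interval. -/
theorem interval_induction (P : R.Pt → Prop) [hP : DefP Set.univ (fun v => P (R.toPt (v 0)))]
    {p q : R.Pt} (hp : P p)
    (hr : ∀ s, p ≤ s → s < q → (∀ r, p ≤ r → r ≤ s → P r) →
      ∃ δ, 0 < δ ∧ ∀ r, s < r → r < s + δ → P r)
    (hl : ∀ s, p < s → s ≤ q → (∀ r, p ≤ r → r < s → P r) → P s) {x : R.Pt} (hpx : p ≤ x)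
    (hxq : x ≤ q) : P x := by
  have inst := DefP.compPt hP
  -- The supremum `σ` of the points up to which `P` holds throughout: `hl` gives `P σ`, and if `σ <
  -- q` then `hr` pushes `P` past `σ`.
  obtain ⟨σ, hσ⟩ := exists_isLUB (fun s => p ≤ s ∧ s ≤ q ∧ ∀ r, p ≤ r → r ≤ s → P r)
    ⟨p, le_rfl, hpx.trans hxq, fun r h₁ h₂ => by rwa [le_antisymm h₂ h₁]⟩ q fun s hs => hs.2.1
  have hpσ : p ≤ σ := hσ.1 ⟨le_rfl, hpx.trans hxq, fun r h₁ h₂ => by rwa [le_antisymm h₂ h₁]⟩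
  have hσq : σ ≤ q := hσ.2 fun s hs => hs.2.1
  have below : ∀ r, p ≤ r → r < σ → P r := fun r hr hrσ => by
    by_contra hPr
    have : σ ≤ r := hσ.2 fun s hs => by
      by_contra! hsr
      exact hPr (hs.2.2 r hr hsr.le)
    linarith
  have hPσ : P σ := by
    rcases hpσ.eq_or_lt with h | h
    · rwa [← h]
    · exact hl σ h hσq below
  have upto : ∀ r, p ≤ r → r ≤ σ → P r := fun r hr hrσ => by
    rcases hrσ.eq_or_lt with h | h
    · rwa [h]
    · exact below r hr h
  rcases hσq.eq_or_lt with h | h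
  · exact upto x hpx (h ▸ hxq)
  · obtain ⟨δ, hδ, h'⟩ := hr σ hpσ h upto
    have h₀ : σ < min (σ + δ / 2) q := lt_min (by linarith) h
    have : min (σ + δ / 2) q ≤ σ := hσ.1 ⟨by linarith, min_le_right _ _, fun r hpr hr => by
      rcases le_or_gt r σ with h₁ | h₁
      · exact upto r hpr h₁
      · exact h' r h₁ (by linarith [min_le_left (σ + δ / 2) q])⟩
    linarith

/-- `f` is continuous, in the sense of the universe. -/
def Cont (f : R.Pt → R.Pt) : Prop :=
  ∀ x η : R.Pt, 0 < η → ∃ δ : R.Pt, 0 < δ ∧ ∀ z, |z - x| < δ → |f z - f x| < η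

/-- The intermediate value theorem in the form needed below. Positivity persists to the right by
continuity, and a limit of points with positive value cannot have a negative value. -/
theorem pos_of_ne_zero (f : R.Pt → R.Pt) [DefF Set.univ f] (hf : Cont f) {p q : R.Pt}
    (hp : 0 < f p) (h : ∀ x, p ≤ x → x ≤ q → f x ≠ 0) {x : R.Pt} (hpx : p ≤ x) (hxq : x ≤ q) :
    0 < f x := by
  refine interval_induction (fun x => 0 < f x) (p := p) (q := q) hp ?_ ?_ hpx hxq
  · intro s hps hsq hs
    obtain ⟨δ, hδ, h'⟩ := hf s (f s) (hs s hps le_rfl)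
    refine ⟨δ, hδ, fun r h₁ h₂ => ?_⟩
    have := (abs_lt.1 (h' r (abs_lt.2 ⟨by linarith, by linarith⟩))).1
    linarith
  · intro s hps hsq hs
    by_contra! hneg
    have hneg := lt_of_le_of_ne hneg (h s hps.le hsq)
    obtain ⟨δ, hδ, h'⟩ := hf s (-f s) (by linarith)
    obtain ⟨r, hr, hrs⟩ : ∃ r, max p (s - δ) < r ∧ r < s :=
      exists_between (max_lt hps (by linarith))
    have h₁ := le_max_left p (s - δ)
    have h₂ := le_max_right p (s - δ)
    have := (abs_lt.1 (h' r (abs_lt.2 ⟨by linarith, by linarith⟩))).2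
    linarith [hs r (by linarith) hrs]

/-- Around each point `f` lies strictly above its value there to the right and strictly below it to
the left; interval induction chains these local comparisons. -/
theorem lt_of_deriv_pos (f d : R.Pt → R.Pt) [DefF Set.univ f] {p q : R.Pt} (hpq : p < q)
    (hf : ∀ x ∈ Set.Icc p q, HasDerivOn (Set.Icc p q) f (d x) x)
    (hd : ∀ x, p ≤ x → x ≤ q → 0 < d x) : f p < f q := by
  -- With error at most half the derivative, the increment from `s` has the sign of `z - s`.
  have hpos : ∀ s, p ≤ s → s ≤ q → ∃ δ : R.Pt, 0 < δ ∧ ∀ z, p ≤ z → z ≤ q → |z - s| < δ →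
      (s < z → f s < f z) ∧ (z < s → f z < f s) := fun s hps hsq => by
    have hds := hd s hps hsq
    obtain ⟨δ, hδ, h⟩ := hf s ⟨hps, hsq⟩ (d s / 2) (by linarith)
    refine ⟨δ, hδ, fun z hpz hzq hz => ?_⟩
    have h := abs_le.1 (h z ⟨hpz, hzq⟩ hz)
    refine ⟨fun hsz => ?_, fun hzs => ?_⟩
    · rw [abs_of_pos (by linarith)] at h
      have : 0 < d s / 2 * (z - s) := mul_pos (by linarith) (by linarith)
      linarith
    · rw [abs_of_neg (by linarith)] at h
      have : 0 < d s / 2 * (s - z) := mul_pos (by linarith) (by linarith)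
      linarith
  have := interval_induction (fun x => p < x → x ≤ q → f p < f x) (p := p) (q := q) (by simp) ?_ ?_
    hpq.le le_rfl hpq le_rfl
  · exact this
  · intro s hps hsq hs
    obtain ⟨δ, hδ, h⟩ := hpos s hps hsq.le
    refine ⟨δ, hδ, fun r h₁ h₂ hpr hrq => ?_⟩
    have h₃ := (h r hpr.le hrq (abs_lt.2 ⟨by linarith, by linarith⟩)).1 h₁
    rcases hps.eq_or_lt with rfl | h₄
    · exact h₃
    · exact (hs s hps le_rfl h₄ hsq.le).trans h₃
  · intro s hps hsq hs _ _
    obtain ⟨δ, hδ, h⟩ := hpos s hps.le hsq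
    obtain ⟨r, hr, hrs⟩ : ∃ r, max p (s - δ) < r ∧ r < s :=
      exists_between (max_lt hps (by linarith))
    have h₁ := le_max_left p (s - δ)
    have h₂ := le_max_right p (s - δ)
    have h₃ := (h r (by linarith) (by linarith) (abs_lt.2 ⟨by linarith, by linarith⟩)).2 hrs
    exact (hs r (by linarith) hrs (by linarith) (by linarith)).trans h₃

/-- The mean value theorem for a function with a continuous derivative. -/
theorem exists_deriv_eq_slope (f d : R.Pt → R.Pt) [DefF Set.univ f] [DefF Set.univ d]
    {p q : R.Pt} (hpq : p < q)
    (hf : ∀ x ∈ Set.Icc p q, HasDerivOn (Set.Icc p q) f (d x) x) (hd : Cont d) :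
    ∃ x, p ≤ x ∧ x ≤ q ∧ f q - f p = d x * (q - p) := by
  by_contra! h
  set m := (f q - f p) / (q - p) with hm
  have hm' : m * (q - p) = f q - f p := div_mul_cancel₀ _ (by linarith)
  have hne : ∀ x, p ≤ x → x ≤ q → d x ≠ m := fun x hpx hxq e => h x hpx hxq (by rw [e, hm'])
  have i₁ : DefF Set.univ (fun z => d z - m) := ⟨by infer_instance⟩
  have i₂ : DefF Set.univ (fun z => m - d z) := ⟨by infer_instance⟩
  have i₃ : DefF Set.univ (fun z => f z - m * z) := ⟨by infer_instance⟩
  have i₄ : DefF Set.univ (fun z => m * z - f z) := ⟨by infer_instance⟩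
  -- A continuous derivative that never equals the slope `m` stays on one side of it. Then `f - m z`
  -- or its negative is strictly increasing, although its values at `p` and `q` agree.
  rcases lt_or_gt_of_ne (hne p le_rfl hpq.le) with hlt | hlt
  · have hc : Cont (fun z => m - d z) := fun x η hη => by
      obtain ⟨δ, hδ, h⟩ := hd x η hη
      refine ⟨δ, hδ, fun z hz => ?_⟩
      rw [← abs_neg]; convert h z hz using 2; ring
    have := lt_of_deriv_pos (fun z => m * z - f z) (fun z => m - d z) hpq
      (fun x hx => (hf x hx).mul_sub m) fun x hpx hxq =>
        pos_of_ne_zero (fun z => m - d z) hc (p := p) (q := q) (by linarith)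
          (fun x h₁ h₂ e => hne x h₁ h₂ (by linarith)) hpx hxq
    linarith
  · have hc : Cont (fun z => d z - m) := fun x η hη => by
      obtain ⟨δ, hδ, h⟩ := hd x η hη
      refine ⟨δ, hδ, fun z hz => ?_⟩
      convert h z hz using 2; ring
    have := lt_of_deriv_pos (fun z => f z - m * z) (fun z => d z - m) hpq
      (fun x hx => (hf x hx).sub_mul m) fun x hpx hxq =>
        pos_of_ne_zero (fun z => d z - m) hc (p := p) (q := q) (by linarith)
          (fun x h₁ h₂ e => hne x h₁ h₂ (by linarith)) hpx hxq
    linarith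

end Analysis
end RealLine

/-! ## Recursion on the natural numbers -/

namespace RealLine

section Recursion

variable {M : Type*} [SetUniverse M] [hZ : Fact (IsZF M)] {R : RealLine M}

/-- The graph of `f` is the least relation containing `(0, w₀)` and closed under the recursion step.
The bound `W` on the values makes the relations used in its inductions sets by separation, and `f`
needs no parameters beyond those of `g` and `w₀`. -/
theorem exists_recursion {A : Set M} [Params A R] (g : R.Pt → M → M) (w₀ : M)
    (hg : DefP A (fun v => v 2 = g (R.toPt (v 1)) (v 0))) [h₀ : DefT A (fun _ => w₀)] (W : M)
    (hw₀ : w₀ ∈ₘ W) (hW : ∀ k w, w ∈ₘ W → g k w ∈ₘ W) :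
    ∃ f : R.Pt → M, DefP A (fun v => v 1 = f (R.toPt (v 0))) ∧ f 0 = w₀ ∧
      ∀ k ∈ R.naturals, f (k + 1) = g k (f k) := by
  have ig : ∀ {A : Set M} (_ : DefP A (fun v => v 2 = g (R.toPt (v 1)) (v 0)))
      (t₁ : (ℕ → M) → R.Pt) (t₂ : (ℕ → M) → M)
      [DefT A (fun v => (t₁ v).1)] [DefT A t₂], DefT A (fun v => g (t₁ v) (t₂ v)) := by
    intro A hg t₁ t₂ _ _
    have := DefT.comp₂ (f := fun m n => g (R.toPt m) n) hg (fun v => (t₁ v).1) t₂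
    simpa using this
  let J : R.Pt → M → Prop := fun k w => ∀ S, (opair (0 : R.Pt).1 w₀ ∈ₘ S ∧
    ∀ (k : R.Pt) w, opair k.1 w ∈ₘ S → opair (k + 1).1 (g k w) ∈ₘ S) → opair k.1 w ∈ₘ S
  have iJ : ∀ {A : Set M} [Params A R] (_ : DefP A (fun v => v 2 = g (R.toPt (v 1)) (v 0)))
      (_ : DefT A (fun _ => w₀)) (t₁ : (ℕ → M) → R.Pt) (t₂ : (ℕ → M) → M)
      [DefT A (fun v => (t₁ v).1)] [DefT A t₂], DefP A (fun v => J (t₁ v) (t₂ v)) := by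
    intro A _ hg _ t₁ t₂ _ _
    have := ig hg
    have := DefP.comp₂ (A := A) (P := fun m n => J (R.toPt m) n)
      (by simp only [J]; infer_instance) (fun v => (t₁ v).1) t₂
    simpa using this
  have iJ₁ := iJ hg inferInstance
  have iJ₂ := iJ hg.univ h₀.univ
  have ig₂ := ig hg.univ
  have J0 : J 0 w₀ := fun S hS => hS.1
  have J1 : ∀ k w, J k w → J (k + 1) (g k w) := fun k w h S hS => hS.2 k w (h S hS)
  -- Induction over the least closed relation: the pairs in `R.carrier × W` that satisfy `Q` form a
  -- closed set.
  have ind : ∀ (Q : R.Pt → M → Prop) [DefP Set.univ (fun v => Q (R.toPt (v 1)) (v 0))],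
      Q 0 w₀ → (∀ k w, Q k w → Q (k + 1) (g k w)) → ∀ k w, J k w → Q k w := by
    intro Q _ hQ0 hQ1 k w hJ
    obtain ⟨S, hS⟩ := exists_rel (fun x w => Q (R.toPt x) w) R.carrier W
    have hS' : ∀ (k : R.Pt) w, opair k.1 w ∈ₘ S ↔ w ∈ₘ W ∧ Q k w := by
      intro k w
      rw [hS]
      constructor
      · rintro ⟨x, w', -, hw, hQ, e⟩
        obtain ⟨rfl, rfl⟩ := opair_inj.1 e
        exact ⟨hw, by simpa using hQ⟩
      · rintro ⟨h, h'⟩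
        exact ⟨k.1, w, k.2, h, by simpa using h', rfl⟩
    refine ((hS' k w).1 (hJ S ⟨(hS' _ _).2 ⟨hw₀, hQ0⟩, fun k w h => ?_⟩)).2
    have := (hS' k w).1 h
    exact (hS' _ _).2 ⟨hW k w this.1, hQ1 k w this.2⟩
  -- Inversion: a pair enters `J` only as the initial pair or through a step. Functionality of `J`
  -- follows from this.
  have inv : ∀ k w, J k w → (k = 0 ∧ w = w₀) ∨ ∃ k' w', J k' w' ∧ k = k' + 1 ∧ w = g k' w' := by
    refine ind _ (Or.inl ⟨rfl, rfl⟩) fun k w h => Or.inr ⟨k, w, ?_, rfl, rfl⟩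
    rcases h with ⟨rfl, rfl⟩ | ⟨k', w', h, rfl, rfl⟩
    · exact J0
    · exact J1 _ _ h
  have nat : ∀ k w, J k w → k ∈ R.naturals :=
    ind (fun k _ => k ∈ R.naturals) zero_mem_naturals fun k w h => add_one_mem_naturals h
  have fn : ∀ k ∈ R.naturals, ∀ w w', J k w → J k w' → w = w' := by
    intro k hk
    refine naturals_induction (fun k => ∀ w w', J k w → J k w' → w = w') ?_ ?_ hk
    · intro w w' h h'
      have aux : ∀ w, J 0 w → w = w₀ := fun w h => by
        rcases inv 0 w h with ⟨-, e⟩ | ⟨k, v, hJ, e, -⟩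
        · exact e
        · linarith [nonneg_of_mem_naturals (nat k v hJ)]
      rw [aux w h, aux w' h']
    · intro k hk ih w w' h h'
      have aux : ∀ w, J (k + 1) w → ∃ v, J k v ∧ w = g k v := fun w h => by
        rcases inv _ w h with ⟨e, -⟩ | ⟨k', v, hJ, e, e'⟩
        · linarith [nonneg_of_mem_naturals hk]
        · obtain rfl : k = k' := by linarith
          exact ⟨v, hJ, e'⟩
      obtain ⟨v, hv, rfl⟩ := aux w h
      obtain ⟨v', hv', rfl⟩ := aux w' h'
      rw [ih v v' hv hv']
  have tot : ∀ k ∈ R.naturals, ∃ w, J k w := fun k hk =>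
    naturals_induction (fun k => ∃ w, J k w) ⟨_, J0⟩ (fun k _ ⟨w, h⟩ => ⟨_, J1 k w h⟩) hk
  classical
  let f : R.Pt → M := fun k => if h : ∃ w, J k w then h.choose else w₀
  have hf : ∀ k w, J k w → w = f k := fun k w h => by
    have h' : ∃ w, J k w := ⟨w, h⟩
    simp only [f, dif_pos h']
    exact fn k (nat k w h) _ _ h h'.choose_spec
  refine ⟨f, ?_, (hf 0 _ J0).symm, fun k hk => ?_⟩
  · refine DefP.of_iff (P := fun v => J (R.toPt (v 0)) (v 1) ∨ (¬ ∃ w, J (R.toPt (v 0)) w) ∧ v 1 = w₀)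
      inferInstance fun v => ?_
    by_cases h : ∃ w, J (R.toPt (v 0)) w
    · obtain ⟨w, hw⟩ := h
      rw [← hf _ w hw]
      constructor
      · rintro h; rw [h]; exact Or.inl hw
      · rintro (h | h)
        · exact fn _ (nat _ _ hw) _ _ h hw
        · exact absurd ⟨w, hw⟩ h.1
    · simp only [f, dif_neg h, h, not_false_eq_true, true_and]
      refine ⟨Or.inr, ?_⟩
      rintro (h' | h')
      · exact absurd ⟨_, h'⟩ h
      · exact h'
  · obtain ⟨w, hw⟩ := tot k hk
    rw [← hf _ _ hw, ← hf _ _ (J1 k w hw)]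

/-- Recursion for sequences of real numbers. -/
theorem exists_recursion_pt {A : Set M} [Params A R] (g : R.Pt → R.Pt → R.Pt) [hg : DefF₂ A g]
    (w₀ : R.Pt) [DefT A (fun _ => w₀.1)] :
    ∃ f : R.Pt → R.Pt, DefF A f ∧ f 0 = w₀ ∧ ∀ k ∈ R.naturals, f (k + 1) = g k (f k) := by
  obtain ⟨f, h, h₀, h₁⟩ := exists_recursion (A := A) (fun k w => (g k (R.toPt w)).1) w₀.1
    (by infer_instance) R.carrier w₀.2 fun k w _ => (g k (R.toPt w)).2
  have hf : ∀ t : (ℕ → M) → R.Pt, [DefT A (fun v => (t v).1)] → DefT A (fun v => f (t v)) := by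
    intro t _
    have := DefT.comp₁ (f := fun m => f (R.toPt m)) h (fun v => (t v).1)
    simpa using this
  refine ⟨fun k => R.toPt (f k), ⟨by infer_instance⟩, by simp [h₀], fun k hk => ?_⟩
  simp [h₁ k hk]

/-- The numerals: an injective map from the natural numbers of the real line to `ℕ`. -/
theorem exists_numeral (A : Set M) [Params A R] :
    ∃ ν : R.Pt → M, DefP A (fun v => v 1 = ν (R.toPt (v 0))) ∧ (∀ n ∈ R.naturals, IsNatural (ν n)) ∧
      ∀ m ∈ R.naturals, ∀ n ∈ R.naturals, ν m = ν n → m = n := by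
  obtain ⟨s, hs⟩ := hZ.1.infinity
  rw [isInductive_iff] at hs
  obtain ⟨ν, h, h₀, h₁⟩ := exists_recursion (A := A) (R := R) (fun _ w => succ w) (emptySet M)
    (by infer_instance) s hs.1 fun _ w => hs.2 w
  have hν : ∀ t : (ℕ → M) → R.Pt, [DefT Set.univ (fun v => (t v).1)] →
      DefT Set.univ (fun v => ν (t v)) := by
    intro t _
    have := DefT.comp₁ (f := fun m => ν (R.toPt m)) h.univ (fun v => (t v).1)
    simpa using this
  refine ⟨ν, h, fun n hn => ?_, fun m hm => ?_⟩
  · refine naturals_induction (fun n => IsNatural (ν n)) ?_ ?_ hn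
    · intro s hs
      rw [h₀]
      exact (isInductive_iff.1 hs).1
    · intro k hk ih s hs
      rw [h₁ k hk]
      exact (isInductive_iff.1 hs).2 _ (ih s hs)
  · have cases : ∀ n ∈ R.naturals, n = 0 ∨ ∃ k ∈ R.naturals, n = k + 1 := fun n hn => by
      by_cases h : n = 0
      · exact Or.inl h
      · exact Or.inr ⟨n - 1, sub_one_mem_naturals hn h, by ring⟩
    refine naturals_induction (fun m => ∀ n, n ∈ R.naturals → ν m = ν n → m = n) ?_ ?_ hm
    · intro n hn e
      rcases cases n hn with rfl | ⟨k, hk, rfl⟩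
      · rfl
      · rw [h₀, h₁ k hk] at e
        exact absurd e.symm (succ_ne_emptySet _)
    · intro m hm ih n hn e
      rcases cases n hn with rfl | ⟨k, hk, rfl⟩
      · rw [h₀, h₁ m hm] at e
        exact absurd e (succ_ne_emptySet _)
      · rw [h₁ m hm, h₁ k hk] at e
        rw [ih k hk (succ_inj e)]

end Recursion
end RealLine

/-! ## Standard real numbers -/

namespace RealLine

section Standard

variable {M : Type*} [SetUniverse M] {R : RealLine M}

theorem Near.symm {x y : R.Pt} (h : Near x y) : Near y x := fun n hn hs h0 => by
  rw [abs_sub_comm]; exact h n hn hs h0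

theorem Near.neg {x y : R.Pt} (h : Near x y) : Near (-x) (-y) := fun n hn hs h0 => by
  have := h n hn hs h0
  rwa [neg_sub_neg, abs_sub_comm]

variable [hS : Fact (IsSPOT M)]

theorem transfer_pt (P : R.Pt → Prop) [DefP (Standards M) (fun v => P (R.toPt (v 0)))]
    (h : ∀ x : R.Pt, std x.1 → P x) (x : R.Pt) : P x := by
  have := transfer (fun m => m ∈ₘ R.carrier → P (R.toPt m))
    (fun m hm hmR => h _ (by rwa [val_toPt hmR])) x.1 x.2
  simpa using this

theorem exists_std_pt (P : R.Pt → Prop) [DefP (Standards M) (fun v => P (R.toPt (v 0)))]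
    (h : ∃ x, P x) : ∃ x : R.Pt, std x.1 ∧ P x := by
  by_contra! h'
  obtain ⟨x, hx⟩ := h
  exact transfer_pt (fun x => ¬ P x) h' x hx

/-- Standard Part for sets of natural numbers of the real line. -/
theorem exists_std_natural_set (P : R.Pt → Prop)
    [hP : DefP Set.univ (fun v => P (R.toPt (v 0)))] :
    ∃ B, std B ∧ ∀ n ∈ R.naturals, std n.1 → (n.1 ∈ₘ B ↔ P n) := by
  -- The axiom concerns the set-theoretic natural numbers. The numeral map carries `P` there, and
  -- since it is definable from standard parameters, the standard set obtained pulls back to a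
  -- standard set of reals.
  obtain ⟨ν, hν, hnat, hinj⟩ := exists_numeral (R := R) (Standards M)
  have iν : ∀ {A : Set M} [Params A R] (_ : DefP A (fun v => v 1 = ν (R.toPt (v 0))))
      (t : (ℕ → M) → R.Pt) [DefT A (fun v => (t v).1)], DefT A (fun v => ν (t v)) := by
    intro A _ hν t _
    have := DefT.comp₁ (f := fun m => ν (R.toPt m)) hν (fun v => (t v).1)
    simpa using this
  have iν₁ := iν hν
  have iν₂ := iν hν.univ
  have iP := DefP.compPt hP
  obtain ⟨s, hs⟩ := hS.1.infinity
  obtain ⟨C, hC⟩ := exists_sep (fun m => ∃ n, n ∈ R.naturals ∧ P n ∧ m = ν n) s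
  obtain ⟨B, hB, -, hBC⟩ := hS.1.standard_part C fun m hm => by
    obtain ⟨-, n, hn, -, rfl⟩ := (hC m).1 hm
    exact hnat n hn
  have := Fact.std hB
  obtain ⟨B', hB', h⟩ := exists_std_sep (fun m => ν (R.toPt m) ∈ₘ B) R.carrier R.std_carrier
  refine ⟨B', hB', fun n hn hsn => ?_⟩
  have := Fact.std hsn
  rw [h, toPt_val, hBC _ (std_of_def _) (hnat n hn), hC]
  constructor
  · rintro ⟨-, -, m, hm, hPm, e⟩
    rwa [hinj n hn m hm e]
  · exact fun h => ⟨n.2, hnat n hn s hs, n, hn, h, rfl⟩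

/-- Let `B` be the standard set with the same standard natural elements as `{k | k < m}`. It misses
`n`, so by Transfer the least natural number missing from `B` is standard, and that number is `m`.
-/
theorem std_of_le_natural {m n : R.Pt} (hm : m ∈ R.naturals) (hn : n ∈ R.naturals)
    (hsn : std n.1) (h : m ≤ n) : std m.1 := by
  obtain ⟨B, hB, hBm⟩ := exists_std_natural_set (fun k : R.Pt => k < m)
  have := Fact.std hB
  have hnB : ¬ n.1 ∈ₘ B := fun h' => by
    have := (hBm n hn hsn).1 h'
    linarith
  obtain ⟨k, hk⟩ := exists_least (fun k => ¬ k.1 ∈ₘ B) hn hnB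
  obtain ⟨k, hsk, hk, hkB, hk'⟩ := exists_std_pt (fun k : R.Pt => k ∈ R.naturals ∧ ¬ k.1 ∈ₘ B ∧
    ∀ j, j ∈ R.naturals → j < k → ¬ ¬ j.1 ∈ₘ B) ⟨k, hk⟩
  have hmk : m ≤ k := not_lt.1 fun h => hkB ((hBm k hk hsk).2 h)
  have : m = k := by
    rcases eq_or_ne k 0 with rfl | hk0
    · exact le_antisymm hmk (nonneg_of_mem_naturals hm)
    · have := Fact.std hsk
      have hk1 := sub_one_mem_naturals hk hk0
      have hs1 : std (k - 1).1 := std_of_def _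
      have := (hBm _ hk1 hs1).1 (not_not.1 (hk' _ hk1 (by linarith)))
      have := add_one_le_of_lt hk1 hm this
      linarith
  rwa [this]

theorem exists_std_natural_gt {b : R.Pt} (hb : std b.1) :
    ∃ n ∈ R.naturals, std n.1 ∧ b < n := by
  have := Fact.std hb
  obtain ⟨n, hn, hbn⟩ := exists_natural_gt b
  obtain ⟨n, hs, hn, h⟩ := exists_std_pt (fun n => n ∈ R.naturals ∧ b < n) ⟨n, hn, hbn⟩
  exact ⟨n, hn, hs, h⟩

theorem std_of_le {m b : R.Pt} (hm : m ∈ R.naturals) (hb : std b.1) (h : m ≤ b) : std m.1 := by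
  obtain ⟨n, hn, hs, hbn⟩ := exists_std_natural_gt hb
  exact std_of_le_natural hm hn hs (by linarith)

theorem limited_of_le {x b : R.Pt} (hb : std b.1) (h : |x| ≤ b) : Limited x := by
  obtain ⟨n, hn, hs, hbn⟩ := exists_std_natural_gt hb
  exact ⟨n, hn, hs, by linarith⟩

theorem not_std_of_not_limited {N : R.Pt} (h : ¬ Limited N) : ¬ std N.1 := fun hN => by
  have := Fact.std hN
  exact h (limited_of_le (b := |N|) (std_of_def _) le_rfl)

theorem lt_of_std {b n : R.Pt} (hn : n ∈ R.naturals) (hn' : ¬ std n.1) (hb : std b.1) : b < n :=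
  not_le.1 fun h => hn' (std_of_le hn hb h)

/-- Overspill. -/
theorem overspill (P : R.Pt → Prop) [hP : DefP Set.univ (fun v => P (R.toPt (v 0)))] {N : R.Pt}
    (hN : N ∈ R.naturals) (hN' : ¬ std N.1) (h : ∀ n ∈ R.naturals, std n.1 → P n) :
    ∃ n ∈ R.naturals, ¬ std n.1 ∧ P n := by
  by_cases hPN : P N
  · exact ⟨N, hN, hN', hPN⟩
  -- The least failure `m` is nonstandard, so its predecessor is a nonstandard number that satisfies
  -- `P`.
  obtain ⟨m, hm, hPm, hm'⟩ := exists_least (fun n => ¬ P n) hN hPN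
  have hsm : ¬ std m.1 := fun hs => hPm (h m hm hs)
  have hm0 : m ≠ 0 := by
    rintro rfl; exact hsm (std_of_def _)
  have hm1 := sub_one_mem_naturals hm hm0
  refine ⟨m - 1, hm1, fun hs => hsm ?_, not_not.1 (hm' _ hm1 (by linarith))⟩
  have := Fact.std hs
  have : std (m - 1 + 1).1 := std_of_def _
  simpa using this

theorem near_iff {x r : R.Pt} : Near x r ↔ ∀ δ : R.Pt, std δ.1 → 0 < δ → |x - r| < δ := by
  constructor
  · intro h δ hδ hδ0
    have := Fact.std hδ
    obtain ⟨n, hn, hs, h1⟩ := exists_std_natural_gt (b := 1 / δ) (std_of_def _)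
    have hn0 : 0 < n := (one_div_pos.2 hδ0).trans h1
    exact (h n hn hs hn0.ne').trans_lt ((one_div_lt hδ0 hn0).1 h1)
  · intro h n hn hs hn0
    have := Fact.std hs
    exact (h (1 / n) (std_of_def _)
      (one_div_pos.2 ((nonneg_of_mem_naturals hn).lt_of_ne' hn0))).le

theorem Near.refl (x : R.Pt) : Near x x := near_iff.2 fun δ _ hδ => by simpa

theorem Near.add {x y x' y' : R.Pt} (h : Near x y) (h' : Near x' y') : Near (x + x') (y + y') := by
  rw [near_iff] at *
  intro δ hδ hδ0
  have := Fact.std hδ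
  have h₁ := abs_lt.1 (h (δ / 2) (std_of_def _) (by linarith))
  have h₂ := abs_lt.1 (h' (δ / 2) (std_of_def _) (by linarith))
  exact abs_lt.2 ⟨by linarith, by linarith⟩

theorem Near.sub {x y x' y' : R.Pt} (h : Near x y) (h' : Near x' y') :
    Near (x - x') (y - y') := by
  simpa only [sub_eq_add_neg] using h.add h'.neg

theorem near_zero_iff {x y : R.Pt} : Near (x - y) 0 ↔ Near x y := by
  simp [near_iff]

theorem Near.trans {x y z : R.Pt} (h : Near x y) (h' : Near y z) : Near x z := by
  have := h.add h'
  rw [← near_zero_iff] at this ⊢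
  convert this using 1; ring

theorem Near.of_abs_le {x y z : R.Pt} (h : Near z 0) (hxy : |x - y| ≤ z) : Near x y := by
  rw [near_iff] at *
  intro δ hδ hδ0
  have := abs_lt.1 (h δ hδ hδ0)
  simp only [sub_zero] at this
  exact hxy.trans_lt this.2

theorem Near.mul_limited {x b : R.Pt} (h : Near x 0) (hb : std b.1) : Near (b * x) 0 := by
  rw [near_iff] at *
  intro δ hδ hδ0
  have := Fact.std hδ
  have := Fact.std hb
  have h1 : 0 < |b| + 1 := by positivity
  -- The summand `1` keeps the divisor positive when `b = 0`.
  have := h (δ / (|b| + 1)) (std_of_def _) (by positivity)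
  rw [sub_zero, lt_div_iff₀ h1] at this
  rw [sub_zero, abs_mul]
  nlinarith [abs_nonneg x]

theorem near_one_div {n : R.Pt} (hn : n ∈ R.naturals) (h : ¬ std n.1) : Near (1 / n) 0 := by
  rw [near_iff]
  intro δ hδ hδ0
  have := Fact.std hδ
  have h1 := lt_of_std hn h (b := 1 / δ) (std_of_def _)
  have hn0 : 0 < n := (one_div_pos.2 hδ0).trans h1
  rw [sub_zero, abs_of_pos (one_div_pos.2 hn0)]
  exact (one_div_lt hδ0 hn0).1 h1

theorem le_of_near {x y r s : R.Pt} (hx : Near x r) (hy : Near y s) (hr : std r.1) (hs : std s.1)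
    (h : x ≤ y) : r ≤ s := by
  by_contra! hlt
  have := Fact.std hr
  have := Fact.std hs
  have h₁ := abs_lt.1 (near_iff.1 hx ((r - s) / 2) (std_of_def _) (by linarith))
  have h₂ := abs_lt.1 (near_iff.1 hy ((r - s) / 2) (std_of_def _) (by linarith))
  linarith

theorem eq_of_near {r s : R.Pt} (hr : std r.1) (hs : std s.1) (h : Near r s) : r = s :=
  le_antisymm (le_of_near (Near.refl r) h hr hs le_rfl) (le_of_near h (Near.refl r) hs hr le_rfl)

/-! ### Standard sets of triples of natural numbers and standard parts -/

/-- An injective code for pairs of natural numbers. -/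
def pairCode (a b : R.Pt) : R.Pt := (a + b) * (a + b) + a

theorem pairCode_mem {a b : R.Pt} (ha : a ∈ R.naturals) (hb : b ∈ R.naturals) :
    pairCode a b ∈ R.naturals :=
  add_mem_naturals (mul_mem_naturals (add_mem_naturals ha hb) (add_mem_naturals ha hb)) ha

theorem pairCode_inj {a b c d : R.Pt} (ha : a ∈ R.naturals) (hb : b ∈ R.naturals)
    (hc : c ∈ R.naturals) (hd : d ∈ R.naturals) (h : pairCode a b = pairCode c d) :
    a = c ∧ b = d := by
  -- The code lies in `[(a + b)², (a + b + 1)²)`, so it determines `a + b`, and then `a`.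
  have aux : ∀ {a b c d : R.Pt}, a ∈ R.naturals → b ∈ R.naturals → c ∈ R.naturals →
      d ∈ R.naturals → pairCode a b = pairCode c d → c + d ≤ a + b := by
    intro a b c d ha hb hc hd h
    by_contra! hlt
    have := add_one_le_of_lt (add_mem_naturals ha hb) (add_mem_naturals hc hd) hlt
    have ha := nonneg_of_mem_naturals ha
    have hb := nonneg_of_mem_naturals hb
    have hc := nonneg_of_mem_naturals hc
    unfold pairCode at h
    nlinarith
  have e := le_antisymm (aux hc hd ha hb h.symm) (aux ha hb hc hd h)
  unfold pairCode at h
  rw [e] at h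
  have : a = c := by linarith
  exact ⟨this, by linarith⟩

instance _root_.DefT.pairCode {A : Set M} [Params A R] (t₁ t₂ : (ℕ → M) → R.Pt)
    [DefT A (fun v => (t₁ v).1)] [DefT A (fun v => (t₂ v).1)] :
    DefT A (fun v => (pairCode (t₁ v) (t₂ v) : R.Pt).1) := by
  unfold RealLine.pairCode; infer_instance

theorem exists_std_triple_set (P : R.Pt → R.Pt → R.Pt → Prop)
    [hP : DefP Set.univ (fun v => P (R.toPt (v 2)) (R.toPt (v 1)) (R.toPt (v 0)))] :
    ∃ B, std B ∧ ∀ i ∈ R.naturals, ∀ j ∈ R.naturals, ∀ n ∈ R.naturals,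
      std i.1 → std j.1 → std n.1 → ((pairCode (pairCode i j) n).1 ∈ₘ B ↔ P i j n) := by
  have iP : ∀ (t₁ t₂ t₃ : (ℕ → M) → R.Pt) [DefT Set.univ (fun v => (t₁ v).1)]
      [DefT Set.univ (fun v => (t₂ v).1)] [DefT Set.univ (fun v => (t₃ v).1)],
      DefP Set.univ (fun v => P (t₁ v) (t₂ v) (t₃ v)) := by
    intro t₁ t₂ t₃ _ _ _
    have := DefP.comp₃ (P := fun a b c => P (R.toPt a) (R.toPt b) (R.toPt c)) hP
      (fun v => (t₁ v).1) (fun v => (t₂ v).1) (fun v => (t₃ v).1)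
    simpa using this
  obtain ⟨B, hB, h⟩ := exists_std_natural_set (R := R) (fun c => ∃ i j n, (i ∈ R.naturals ∧
    j ∈ R.naturals ∧ n ∈ R.naturals) ∧ c = pairCode (pairCode i j) n ∧ P i j n)
  refine ⟨B, hB, fun i hi j hj n hn hsi hsj hsn => ?_⟩
  have := Fact.std hsi
  have := Fact.std hsj
  have := Fact.std hsn
  rw [h _ (pairCode_mem (pairCode_mem hi hj) hn) (std_of_def _)]
  constructor
  · rintro ⟨i', j', n', ⟨hi', hj', hn'⟩, e, hP⟩
    obtain ⟨e', rfl⟩ := pairCode_inj (pairCode_mem hi hj) hn (pairCode_mem hi' hj') hn' e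
    obtain ⟨rfl, rfl⟩ := pairCode_inj hi hj hi' hj' e'
    exact hP
  · exact fun hP => ⟨i, j, n, ⟨hi, hj, hn⟩, rfl, hP⟩

/-- The standard part of `x` is the supremum of a standard set of rationals whose standard fractions
`i / n`, with standard `i` and `n`, are those below `x`. The middle coordinate of the triples is a
dummy, set to `0`. -/
theorem exists_std_near {x L : R.Pt} (hx : 0 ≤ x) (hL : std L.1) (hxL : x ≤ L) :
    ∃ r : R.Pt, std r.1 ∧ Near x r := by
  obtain ⟨B, hB, h⟩ := exists_std_triple_set (R := R) (fun i _ n => i ≤ x * n)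
  have := Fact.std hB
  have := Fact.std hL
  let S : R.Pt → Prop := fun z => ∃ i n : R.Pt, (i ∈ R.naturals ∧ n ∈ R.naturals ∧ n ≠ 0) ∧
    (pairCode (pairCode i 0) n).1 ∈ₘ B ∧ z = i / n
  have iS : ∀ (t : (ℕ → M) → R.Pt) [DefT (Standards M) (fun v => (t v).1)],
      DefP (Standards M) (fun v => S (t v)) := fun t _ =>
    DefP.compPt (P := S) (by simp only [S]; infer_instance) t
  have iS' : DefP Set.univ (fun v => S (R.toPt (v 0))) := by simp only [S]; infer_instance
  have hB' : ∀ i ∈ R.naturals, ∀ n ∈ R.naturals, std i.1 → std n.1 →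
      ((pairCode (pairCode i 0) n).1 ∈ₘ B ↔ i ≤ x * n) := fun i hi n hn hsi hsn =>
    h i hi 0 zero_mem_naturals n hn hsi (std_of_def _) hsn
  have ub : ∀ b : R.Pt, std b.1 → x ≤ b → ∀ z, S z → z ≤ b := by
    intro b hb hxb z hz
    by_contra! hbz
    have := Fact.std hb
    obtain ⟨i, n, ⟨hi, hn, hn0⟩, hB, rfl⟩ := hz
    -- Membership in `B` is understood only for standard codes, so Transfer replaces the
    -- counterexample by a standard one, one coordinate at a time.
    obtain ⟨i, hsi, n, ⟨hi, hn, hn0⟩, hB, hbz⟩ := exists_std_pt (fun i : R.Pt => ∃ n : R.Pt,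
      (i ∈ R.naturals ∧ n ∈ R.naturals ∧ n ≠ 0) ∧ (pairCode (pairCode i 0) n).1 ∈ₘ B ∧ b < i / n)
      ⟨i, n, ⟨hi, hn, hn0⟩, hB, hbz⟩
    have := Fact.std hsi
    obtain ⟨n, hsn, ⟨hi, hn, hn0⟩, hB, hbz⟩ := exists_std_pt (fun n : R.Pt =>
      (i ∈ R.naturals ∧ n ∈ R.naturals ∧ n ≠ 0) ∧ (pairCode (pairCode i 0) n).1 ∈ₘ B ∧ b < i / n)
      ⟨n, ⟨hi, hn, hn0⟩, hB, hbz⟩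
    have hn0 : 0 < n := (nonneg_of_mem_naturals hn).lt_of_ne' hn0
    have := (div_le_iff₀ hn0).2 ((hB' i hi n hn hsi hsn).1 hB)
    linarith
  have hS : ∀ i ∈ R.naturals, ∀ n ∈ R.naturals, std i.1 → std n.1 → n ≠ 0 → i ≤ x * n →
      S (i / n) := fun i hi n hn hsi hsn hn0 hin =>
    ⟨i, n, ⟨hi, hn, hn0⟩, (hB' i hi n hn hsi hsn).2 hin, rfl⟩
  obtain ⟨r, hr⟩ := exists_isLUB S ⟨_, hS 0 zero_mem_naturals 1 one_mem_naturals (std_of_def _)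
    (std_of_def _) one_ne_zero (by simpa)⟩ L (ub L hL hxL)
  obtain ⟨r, hsr, hr, hr'⟩ := exists_std_pt
    (fun r => (∀ z, S z → z ≤ r) ∧ ∀ b, (∀ z, S z → z ≤ b) → r ≤ b)
    ⟨r, fun z hz => hr.1 hz, fun b hb => hr.2 hb⟩
  refine ⟨r, hsr, fun n hn hsn hn0 => ?_⟩
  have := Fact.std hsn
  have hnpos : 0 < n := (nonneg_of_mem_naturals hn).lt_of_ne' hn0
  -- Both `x` and `r` lie between `i / n` and `i / n + 1 / n`.
  obtain ⟨i, hi, hix, hxi⟩ := exists_floor (mul_nonneg hx hnpos.le)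
  have hsi : std i.1 := std_of_le (b := L * n) hi (std_of_def _)
    (hix.trans (mul_le_mul_of_nonneg_right hxL hnpos.le))
  have := Fact.std hsi
  have h₁ := hr _ (hS i hi n hn hsi hsn hn0 hix)
  have hxi' : x < i / n + 1 / n := by rw [← add_div, lt_div_iff₀ hnpos]; exact hxi
  have h₂ := hr' (i / n + 1 / n) (ub _ (std_of_def _) hxi'.le)
  have h₃ : i / n ≤ x := (div_le_iff₀ hnpos).2 hix
  exact abs_le.2 ⟨by linarith, by linarith⟩

/-! ### Continuity at standard points -/

/-- `F` is continuous, in the sense of the universe. -/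
def Cont₂ (F : R.Pt → R.Pt → R.Pt) : Prop :=
  ∀ x y η : R.Pt, 0 < η → ∃ δ : R.Pt, 0 < δ ∧ ∀ x' y', |x' - x| < δ → |y' - y| < δ →
    |F x' y' - F x y| < η

/-- For standard data Transfer provides a standard `δ`, which dominates every infinitesimal. -/
theorem Cont₂.exists_std {F : R.Pt → R.Pt → R.Pt} [DefF₂ (Standards M) F] (hF : Cont₂ F)
    {x y η : R.Pt} (hx : std x.1) (hy : std y.1) (hη : std η.1) (h : 0 < η) :
    ∃ δ : R.Pt, std δ.1 ∧ 0 < δ ∧ ∀ x' y', |x' - x| < δ → |y' - y| < δ →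
      |F x' y' - F x y| < η := by
  have := Fact.std hx
  have := Fact.std hy
  have := Fact.std hη
  exact exists_std_pt (fun δ : R.Pt => 0 < δ ∧ ∀ x' y', |x' - x| < δ → |y' - y| < δ →
      |F x' y' - F x y| < η) (hF x y η h)

theorem Cont₂.near {F : R.Pt → R.Pt → R.Pt} [DefF₂ (Standards M) F] (hF : Cont₂ F)
    {x y x' y' : R.Pt} (hx : std x.1) (hy : std y.1) (hxx : Near x' x) (hyy : Near y' y) :
    Near (F x' y') (F x y) := by
  rw [near_iff] at *
  intro η hη hη0
  obtain ⟨δ, hδ, hδ0, h⟩ := hF.exists_std hx hy hη hη0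
  exact h _ _ (hxx δ hδ hδ0) (hyy δ hδ hδ0)

theorem Cont.near {f : R.Pt → R.Pt} [DefF (Standards M) f] (hf : Cont f)
    {x x' : R.Pt} (hx : std x.1) (hxx : Near x' x) : Near (f x') (f x) := by
  have := Fact.std hx
  rw [near_iff] at *
  intro η hη hη0
  have := Fact.std hη
  obtain ⟨δ, hδ, hδ0, h⟩ := exists_std_pt (fun δ : R.Pt => 0 < δ ∧ ∀ z, |z - x| < δ →
      |f z - f x| < η) (hf x η hη0)
  exact h _ (hxx δ hδ hδ0)

end Standard
end RealLine

/-! ## The shadow of an Euler sequence -/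

namespace RealLine

section Shadow

variable {M : Type*} [SetUniverse M] {R : RealLine M}

theorem gridPoint_add (N x₀ k m : R.Pt) : gridPoint N x₀ (k + m) = gridPoint N x₀ k + m * (1 / N) := by
  unfold gridPoint; ring

variable [hS : Fact (IsSPOT M)]

instance _root_.DefT.gridPoint {A : Set M} [Params A R] (t₁ t₂ t₃ : (ℕ → M) → R.Pt)
    [DefT A (fun v => (t₁ v).1)] [DefT A (fun v => (t₂ v).1)] [DefT A (fun v => (t₃ v).1)] :
    DefT A (fun v => (gridPoint (t₁ v) (t₂ v) (t₃ v) : R.Pt).1) := by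
  unfold RealLine.gridPoint; infer_instance

/-- A standard subset of the plane with a given definition. -/
theorem exists_std_plane_set (Q : R.Pt → R.Pt → Prop)
    [hQ : DefP (Standards M) (fun v => Q (R.toPt (v 1)) (R.toPt (v 0)))] :
    ∃ Y : M, std Y ∧ (∀ p, p ∈ₘ Y → ∃ x y : R.Pt, Q x y ∧ IsPair p x.1 y.1) ∧
      ∀ x y : R.Pt, PairMem Y x.1 y.1 ↔ Q x y := by
  have iQ : ∀ (t₁ t₂ : (ℕ → M) → M) [DefT (Standards M) t₁] [DefT (Standards M) t₂],
      DefP (Standards M) (fun v => Q (R.toPt (t₁ v)) (R.toPt (t₂ v))) := fun t₁ t₂ _ _ =>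
    DefP.comp₂ (P := fun a b => Q (R.toPt a) (R.toPt b)) hQ t₁ t₂
  have := hQ.univ
  obtain ⟨Y, hY, h⟩ := exists_std (fun Y => ∀ p, p ∈ₘ Y ↔ ∃ x y, x ∈ₘ R.carrier ∧
    y ∈ₘ R.carrier ∧ Q (R.toPt x) (R.toPt y) ∧ p = opair x y)
    (exists_rel (fun x y => Q (R.toPt x) (R.toPt y)) R.carrier R.carrier)
  refine ⟨Y, hY, fun p hp => ?_, fun x y => ?_⟩
  · obtain ⟨x, y, hx, hy, hQ, rfl⟩ := (h p).1 hp
    exact ⟨_, _, hQ, by rw [val_toPt hx, val_toPt hy]; exact isPair_opair x y⟩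
  · rw [pairMem_iff, h]
    constructor
    · rintro ⟨x', y', -, -, hQ, e⟩
      obtain ⟨rfl, rfl⟩ := opair_inj.1 e
      simpa using hQ
    · exact fun hQ => ⟨x.1, y.1, x.2, y.2, by simpa using hQ, rfl⟩

set_option synthInstance.maxSize 2000 in
-- A triple `(i, j, n)` codes the box around `(i / n, j / n - n)`; the shift by `n` lets the natural
-- number `j` reach negative ordinates. The standard set `B` records which boxes of radius `2 / n`
-- are visited by the sequence, for standard triples. The shadow consists of the points with `0 ≤ x`
-- all of whose boxes of radius `1 / n` have their code in `B`; the doubled radius absorbs the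
-- distance between a standard point and a grid point near it.
theorem exists_shadow {N : R.Pt} (hN : N ∈ R.naturals) (hN' : ¬ std N.1) (x₀ : R.Pt)
    (u : R.Pt → R.Pt) [DefF Set.univ u] : ∃ Y : M, IsShadow N x₀ u Y := by
  obtain ⟨B, hB, h⟩ := exists_std_triple_set (R := R) (fun i j n => ∃ k, k ∈ R.naturals ∧
    k < N ^ 2 ∧ |gridPoint N x₀ k - i / n| ≤ 2 / n ∧ |u k - (j / n - n)| ≤ 2 / n)
  have := Fact.std hB
  obtain ⟨Y, hY, hY₁, hY₂⟩ := exists_std_plane_set (R := R) (fun x y => 0 ≤ x ∧ ∀ i j n,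
    i ∈ R.naturals ∧ j ∈ R.naturals ∧ n ∈ R.naturals → n ≠ 0 → |x - i / n| ≤ 1 / n →
      |y - (j / n - n)| ≤ 1 / n → (pairCode (pairCode i j) n).1 ∈ₘ B)
  refine ⟨Y, hY, fun p hp => ?_, fun x y hx hy hx0 => ?_⟩
  · obtain ⟨x, y, ⟨h, -⟩, hp⟩ := hY₁ p hp
    exact ⟨x, y, h, hp⟩
  have := Fact.std hx
  have := Fact.std hy
  rw [hY₂]
  constructor
  · rintro ⟨-, hxy⟩
    have hstd : ∀ n ∈ R.naturals, std n.1 → |y| ≤ n → n ≠ 0 → ∃ k, k ∈ R.naturals ∧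
        k < N ^ 2 ∧ |x - gridPoint N x₀ k| ≤ 3 * (1 / n) ∧ |y - u k| ≤ 3 * (1 / n) := by
      intro n hn hsn hyn hn0
      have := Fact.std hsn
      have hnpos : 0 < n := (nonneg_of_mem_naturals hn).lt_of_ne' hn0
      have hyn' := abs_le.1 hyn
      -- Rounding down puts `(x, y)` in the box of `(i, j, n)`; the condition `|y| ≤ n` makes `j` a
      -- natural number. The radii `1 / n` and `2 / n` add up to the `3 / n` of the claim.
      obtain ⟨i, hi, hi₁, hi₂⟩ := exists_floor (mul_nonneg hx0 hnpos.le)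
      obtain ⟨j, hj, hj₁, hj₂⟩ := exists_floor (mul_nonneg (by linarith : 0 ≤ y + n) hnpos.le)
      have hsi := std_of_le hi (std_of_def _) hi₁
      have hsj := std_of_le hj (std_of_def _) hj₁
      have hi₁ := (div_le_iff₀ hnpos).2 hi₁
      have hi₂ := (lt_div_iff₀ hnpos).2 hi₂
      have hj₁ := (div_le_iff₀ hnpos).2 hj₁
      have hj₂ := (lt_div_iff₀ hnpos).2 hj₂
      rw [add_div] at hi₂ hj₂
      have h₁ : |x - i / n| ≤ 1 / n := abs_le.2 ⟨by linarith, by linarith⟩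
      have h₂ : |y - (j / n - n)| ≤ 1 / n := abs_le.2 ⟨by linarith, by linarith⟩
      obtain ⟨k, hk, hkN, h₃, h₄⟩ :=
        (h i hi j hj n hn hsi hsj hsn).1 (hxy i j n ⟨hi, hj, hn⟩ hn0 h₁ h₂)
      have e : 2 / n = 2 * (1 / n) := by ring
      rw [e] at h₃ h₄
      refine ⟨k, hk, hkN, ?_, ?_⟩
      · have h₁ := abs_le.1 h₁
        have h₃ := abs_le.1 h₃
        exact abs_le.2 ⟨by linarith, by linarith⟩
      · have h₂ := abs_le.1 h₂
        have h₄ := abs_le.1 h₄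
        exact abs_le.2 ⟨by linarith, by linarith⟩
    -- For a nonstandard `n` the error `3 / n` is infinitesimal, so a single index `k` serves all
    -- standard accuracies.
    obtain ⟨n, hn, hsn, hn'⟩ := overspill (fun n => |y| ≤ n → n ≠ 0 → ∃ k, k ∈ R.naturals ∧
      k < N ^ 2 ∧ |x - gridPoint N x₀ k| ≤ 3 * (1 / n) ∧ |y - u k| ≤ 3 * (1 / n)) hN hN' hstd
    have hn0 : n ≠ 0 := by rintro rfl; exact hsn (std_of_def _)
    obtain ⟨k, hk, hkN, h₁, h₂⟩ := hn' (lt_of_std hn hsn (std_of_def _)).le hn0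
    have := (near_one_div hn hsn).mul_limited (b := 3) (std_of_def _)
    exact ⟨k, hk, hkN, this.of_abs_le h₁, this.of_abs_le h₂⟩
  · rintro ⟨k, hk, hkN, h₁, h₂⟩
    refine ⟨hx0, ?_⟩
    -- Since `x`, `y` and `B` are standard, only standard triples have to be checked.
    refine transfer_pt (R := R) _ fun i hsi => ?_
    have := Fact.std hsi
    refine transfer_pt (R := R) _ fun j hsj => ?_
    have := Fact.std hsj
    refine transfer_pt (R := R) _ fun n hsn => ?_
    rintro ⟨hi, hj, hn⟩ hn0 h₃ h₄
    have h₁ := abs_le.1 (h₁ n hn hsn hn0)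
    have h₂ := abs_le.1 (h₂ n hn hsn hn0)
    have h₃ := abs_le.1 h₃
    have h₄ := abs_le.1 h₄
    have e : 2 / n = 2 * (1 / n) := by ring
    refine (h i hi j hj n hn hsi hsj hsn).2 ⟨k, hk, hkN, ?_, ?_⟩
    · exact abs_le.2 ⟨by linarith, by linarith⟩
    · exact abs_le.2 ⟨by linarith, by linarith⟩

/-- Within an infinitesimal time, an Euler sequence that starts near a standard point moves only
infinitesimally. -/
theorem near_of_euler {F : R.Pt → R.Pt → R.Pt} [DefF₂ (Standards M) F] (hF : Cont₂ F)
    {N x₀ : R.Pt} (hN : 0 < N) {ε u : R.Pt → R.Pt} [DefF Set.univ u]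
    (hε : ∀ k ∈ R.naturals, k < N ^ 2 → Near (ε k) 0)
    (hu : ∀ k ∈ R.naturals, k < N ^ 2 →
      u (k + 1) = u k + (F (gridPoint N x₀ k) (u k) + ε k) * (1 / N))
    {x z k k' : R.Pt} (hx : std x.1) (hz : std z.1) (hk : k ∈ R.naturals) (hk' : k' ∈ R.naturals)
    (hkk : k ≤ k') (hkN : k' < N ^ 2) (hxk : Near x (gridPoint N x₀ k))
    (hxk' : Near x (gridPoint N x₀ k')) (hzk : Near z (u k)) : Near (u k') (u k) := by
  have := Fact.std hx
  have := Fact.std hz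
  have h1N : 0 < 1 / N := one_div_pos.2 hN
  obtain ⟨δ, hδ, hδ0, h⟩ := hF.exists_std hx hz (η := 1) (std_of_def _) one_pos
  have := Fact.std hδ
  -- A bound for `|F + ε|` near `(x, z)`: one unit for the variation of `F` within `δ`, one for the
  -- perturbation.
  set C := |F x z| + 2 with hC
  have hCs : std C.1 := std_of_def _
  have hC0 : 0 < C := by positivity
  set τ := (k' - k) * (1 / N) with hτ
  have hτ' : gridPoint N x₀ k' = gridPoint N x₀ k + τ := by
    rw [hτ, ← gridPoint_add]; congr 1; ring
  have hτ0 : Near τ 0 := by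
    have := near_zero_iff.2 (hxk'.symm.trans hxk)
    rwa [hτ', add_sub_cancel_left] at this
  have hCτ := hτ0.mul_limited hCs
  have hstd : std (δ / 2).1 := std_of_def _
  have h₁ := abs_lt.1 (near_iff.1 hCτ (δ / 2) hstd (by linarith))
  have h₂ := abs_lt.1 (near_iff.1 hzk (δ / 2) hstd (by linarith))
  have h₃ := abs_lt.1 (near_iff.1 hxk δ hδ hδ0)
  have h₄ := abs_lt.1 (near_iff.1 hxk' δ hδ hδ0)
  -- The bound `C` applies while the sequence stays within `δ` of `(x, z)`. It does: `u k` is within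
  -- `δ / 2` of `z`, and the total drift is at most `C * τ < δ / 2`.
  have key : ∀ m ∈ R.naturals, m ≤ k' - k → |u (k + m) - u k| ≤ C * (m * (1 / N)) := by
    intro m hm
    refine naturals_induction (fun m => m ≤ k' - k → |u (k + m) - u k| ≤ C * (m * (1 / N)))
      (by simp) ?_ hm
    intro m hm ih hmk
    have hm0 := nonneg_of_mem_naturals hm
    have ih := ih (by linarith)
    have hkm : k + m < N ^ 2 := by linarith
    have hstep : m * (1 / N) ≤ τ := mul_le_mul_of_nonneg_right (by linarith) h1N.le
    have hmN : 0 ≤ m * (1 / N) := mul_nonneg hm0 h1N.le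
    have hCm := mul_le_mul_of_nonneg_left hstep hC0.le
    have hg := gridPoint_add N x₀ k m
    have ih' := abs_le.1 ih
    have hFb := abs_lt.1 (h (gridPoint N x₀ (k + m)) (u (k + m))
      (abs_lt.2 ⟨by linarith, by linarith⟩) (abs_lt.2 ⟨by linarith, by linarith⟩))
    have hεb := abs_lt.1 (near_iff.1 (hε _ (add_mem_naturals hk hm) hkm) 1 (std_of_def _) one_pos)
    have hb : |F (gridPoint N x₀ (k + m)) (u (k + m)) + ε (k + m)| ≤ C :=
      abs_le.2 ⟨by linarith [neg_abs_le (F x z)], by linarith [le_abs_self (F x z)]⟩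
    rw [← add_assoc, hu _ (add_mem_naturals hk hm) hkm]
    have hb' := mul_le_mul_of_nonneg_right hb h1N.le
    rw [← abs_of_pos h1N, ← abs_mul, abs_of_pos h1N] at hb'
    have hb' := abs_le.1 hb'
    exact abs_le.2 ⟨by linarith, by linarith⟩
  have := key (k' - k) (sub_mem_naturals hk hk' hkk) le_rfl
  rw [add_sub_cancel] at this
  exact hCτ.of_abs_le this

/-- The shadow of an Euler sequence with an infinitesimal perturbation is a function. -/
theorem shadow_unique {F : R.Pt → R.Pt → R.Pt} [DefF₂ (Standards M) F] (hF : Cont₂ F)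
    {N x₀ : R.Pt} (hN : 0 < N) {ε u : R.Pt → R.Pt} [DefF Set.univ u]
    (hε : ∀ k ∈ R.naturals, k < N ^ 2 → Near (ε k) 0)
    (hu : ∀ k ∈ R.naturals, k < N ^ 2 →
      u (k + 1) = u k + (F (gridPoint N x₀ k) (u k) + ε k) * (1 / N))
    {Y : M} (hY : IsShadow N x₀ u Y) (x z z' : R.Pt) (h : PairMem Y x.1 z.1)
    (h' : PairMem Y x.1 z'.1) : z = z' := by
  obtain ⟨hsY, hY₁, hY₂⟩ := hY
  have := Fact.std hsY
  revert x z z'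
  refine transfer_pt (R := R) _ fun x hx => ?_
  have := Fact.std hx
  refine transfer_pt (R := R) _ fun z hz => ?_
  have := Fact.std hz
  refine transfer_pt (R := R) _ fun z' hz' => ?_
  intro h h'
  have hx0 : 0 ≤ x := by
    obtain ⟨p, hp, hpY⟩ := h
    obtain ⟨x', z', h0, hp'⟩ := hY₁ p hpY
    rwa [Subtype.ext (hp.inj hp').1]
  obtain ⟨k, hk, hkN, hxk, hzk⟩ := (hY₂ x z hx hz hx0).1 h
  obtain ⟨k', hk', hkN', hxk', hzk'⟩ := (hY₂ x z' hx hz' hx0).1 h'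
  have hkk : Near (u k') (u k) := by
    rcases le_total k k' with hle | hle
    · exact near_of_euler hF hN hε hu hx hz hk hk' hle hkN' hxk hxk' hzk
    · exact (near_of_euler hF hN hε hu hx hz' hk' hk hle hkN hxk' hxk hzk').symm
  exact eq_of_near hz hz' (hzk.trans (hkk.symm.trans hzk'.symm))

open Classical in
/-- If the shadow of an Euler sequence is a function whose domain contains `[0, c]`, then it
determines a standard function on the component of `0`. -/
theorem exists_eulerSolution {N x₀ : R.Pt} {u y : R.Pt → R.Pt} [DefF (Standards M) y] {Y : M}
    (hY : IsShadow N x₀ u Y)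
    (huniq : ∀ x z z' : R.Pt, PairMem Y x.1 z.1 → PairMem Y x.1 z'.1 → z = z') {c : R.Pt}
    (hc : std c.1) (hYc : ∀ x : R.Pt, std x.1 → 0 ≤ x → x ≤ c → PairMem Y x.1 (y x).1) :
    ∃ (D : Set R.Pt) (f : R.Pt → R.Pt), IsEulerSolution N x₀ u D f ∧
      ∀ x : R.Pt, 0 ≤ x → x ≤ c → x ∈ D ∧ y x = f x := by
  have := Fact.std hY.1
  have := Fact.std hc
  have hYc : ∀ x : R.Pt, 0 ≤ x → x ≤ c → PairMem Y x.1 (y x).1 := transfer_pt (R := R) _ hYc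
  set D : Set R.Pt := Set.ordConnectedComponent {x : R.Pt | ∃ z : R.Pt, PairMem Y x.1 z.1} 0 with hD
  have hmem : ∀ x, x ∈ D ↔ ∀ w : R.Pt, min 0 x ≤ w → w ≤ max 0 x → ∃ z : R.Pt, PairMem Y w.1 z.1 := by
    intro x
    rw [hD, Set.mem_ordConnectedComponent]
    exact ⟨fun h w h₁ h₂ => h ⟨h₁, h₂⟩, fun h w hw => h w hw.1 hw.2⟩
  have hdom : ∀ x ∈ D, ∃ z : R.Pt, PairMem Y x.1 z.1 := fun x hx =>
    (hmem x).1 hx x (min_le_right _ _) (le_max_right _ _)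
  let f : R.Pt → R.Pt := fun x => if h : ∃ z : R.Pt, PairMem Y x.1 z.1 then h.choose else 0
  have hf : ∀ x z : R.Pt, PairMem Y x.1 z.1 → z = f x := fun x z h => by
    have h' : ∃ z : R.Pt, PairMem Y x.1 z.1 := ⟨z, h⟩
    simp only [f, dif_pos h']
    exact huniq x _ _ h h'.choose_spec
  have hf' : ∀ x ∈ D, ∀ z : R.Pt, PairMem Y x.1 z.1 ↔ z = f x := fun x hx z => by
    refine ⟨hf x z, ?_⟩
    obtain ⟨z', hz'⟩ := hdom x hx
    rintro rfl
    rwa [← hf x z' hz']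
  refine ⟨D, f, ⟨Y, hY, rfl, hf', ?_⟩, fun x hx hxc => ⟨(hmem x).2 fun w h₁ h₂ => ?_, ?_⟩⟩
  -- The component of `0` is the set of `x` such that the whole segment between `0` and `x` lies in
  -- the domain, a condition definable from `Y`.
  · obtain ⟨G, hG, hG₁, hG₂⟩ := exists_std_plane_set (R := R) (fun x z => PairMem Y x.1 z.1 ∧
      ∀ w : R.Pt, min 0 x ≤ w → w ≤ max 0 x → ∃ z : R.Pt, PairMem Y w.1 z.1)
    refine ⟨G, hG, fun p => ⟨fun hp => ?_, ?_⟩⟩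
    · obtain ⟨x, z, ⟨h₁, h₂⟩, hp⟩ := hG₁ p hp
      exact ⟨x, (hmem x).2 h₂, by rwa [← hf x z h₁]⟩
    · rintro ⟨x, hx, hp⟩
      obtain ⟨p', hp', hG⟩ := (hG₂ x (f x)).2 ⟨(hf' x hx _).2 rfl, (hmem x).1 hx⟩
      rwa [isPair_iff_eq.1 hp, ← isPair_iff_eq.1 hp']
  · rw [min_eq_left hx] at h₁
    rw [max_eq_right hx] at h₂
    exact ⟨_, hYc w h₁ (h₂.trans hxc)⟩
  · exact hf x _ (hYc x hx hxc)

end Shadow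
end RealLine

/-! ## Euler sequences that follow a solution -/

namespace RealLine

section Follow

variable {M : Type*} [SetUniverse M] {R : RealLine M}

theorem abs_max_min_sub_le (a b x z : R.Pt) :
    |max a (min z b) - max a (min x b)| ≤ |z - x| := by
  rw [max_comm a, max_comm a]
  exact (abs_max_sub_max_le_abs _ _ _).trans (abs_min_sub_min_le_max _ _ _ _ |>.trans (by simp))

/-- Freezing the function outside `[0, c]` makes it total. Differentiability at `p` gives `|f q - f
p| ≤ (|d p| + 1) |q - p|` near `p`, and clamping does not increase distances. -/
theorem cont_clamp {D : Set R.Pt} {f d : R.Pt → R.Pt} (hf : ∀ x ∈ D, HasDerivOn D f (d x) x)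
    {c : R.Pt} (hD : ∀ x, 0 ≤ x → x ≤ c → x ∈ D) (hc : 0 ≤ c) :
    Cont (fun x => f (max 0 (min x c))) := by
  intro x η hη
  set p := max 0 (min x c) with hp
  have hpD : ∀ z, max 0 (min z c) ∈ D := fun z =>
    hD _ (le_max_left _ _) (max_le hc (min_le_right _ _))
  obtain ⟨δ, hδ, h⟩ := hf p (hpD x) 1 one_pos
  have hd : 0 < |d p| + 1 := by positivity
  refine ⟨min δ (η / (|d p| + 1)), lt_min hδ (by positivity), fun z hz => ?_⟩
  have hz' := (abs_max_min_sub_le 0 c x z).trans_lt hz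
  rw [← hp] at hz'
  have h₁ := h _ (hpD z) (hz'.trans_le (min_le_left _ _))
  have h₂ := (lt_div_iff₀ hd).1 (hz'.trans_le (min_le_right _ _))
  set q := max 0 (min z c)
  have h₃ : |f q - f p| ≤ |f q - f p - d p * (q - p)| + |d p * (q - p)| := by
    have := abs_add_le (f q - f p - d p * (q - p)) (d p * (q - p))
    rwa [sub_add_cancel] at this
  rw [abs_mul] at h₃
  linarith

theorem HasDerivOn.congr_subset {D D' : Set R.Pt} {f g : R.Pt → R.Pt} {d x : R.Pt}
    (h : HasDerivOn D f d x) (hD : D' ⊆ D) (hx : x ∈ D') (hfg : ∀ z ∈ D', g z = f z) :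
    HasDerivOn D' g d x := by
  intro η hη
  obtain ⟨δ, hδ, h⟩ := h η hη
  refine ⟨δ, hδ, fun z hz hzx => ?_⟩
  rw [hfg z hz, hfg x hx]
  exact h z (hD hz) hzx

theorem cont_comp₂ {F : R.Pt → R.Pt → R.Pt} {y : R.Pt → R.Pt} (hF : Cont₂ F) (hy : Cont y) :
    Cont (fun x => F x (y x)) := by
  intro x η hη
  obtain ⟨δ, hδ, h⟩ := hF x (y x) η hη
  obtain ⟨δ', hδ', h'⟩ := hy x δ hδ
  exact ⟨min δ δ', lt_min hδ hδ', fun z hz =>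
    h _ _ (hz.trans_le (min_le_left _ _)) (h' z (hz.trans_le (min_le_right _ _)))⟩

theorem ContinuousField.cont₂ {F : R.Pt → R.Pt → R.Pt} (hF : ContinuousField F) :
    Cont₂ (fun x z => F (max x 0) z) := by
  intro x z η hη
  obtain ⟨δ, hδ, h⟩ := hF (max x 0) z (le_max_right _ _) η hη
  exact ⟨δ, hδ, fun x' z' hx hz => h _ _ (le_max_right _ _)
    ((abs_max_sub_max_le_abs _ _ _).trans_lt hx) hz⟩

variable [hS : Fact (IsSPOT M)]

theorem internalOn_of_defF {f : R.Pt → R.Pt} [DefF Set.univ f] (D : Set R.Pt)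
    [hD : DefP Set.univ (fun v => R.toPt (v 0) ∈ D)] : InternalOn D f := by
  have iD : ∀ (t : (ℕ → M) → R.Pt) [DefT Set.univ (fun v => (t v).1)],
      DefP Set.univ (fun v => t v ∈ D) := fun t _ => DefP.compPt (P := fun x => x ∈ D) hD t
  obtain ⟨G, hG⟩ := exists_rel (fun x y => R.toPt x ∈ D ∧ y = (f (R.toPt x)).1)
    R.carrier R.carrier
  refine ⟨G, fun p => (hG p).trans ⟨?_, ?_⟩⟩
  · rintro ⟨x, y, hx, -, ⟨hxD, rfl⟩, rfl⟩
    exact ⟨_, hxD, by rw [val_toPt hx]; exact isPair_opair _ _⟩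
  · rintro ⟨x, hx, hp⟩
    exact ⟨x.1, _, x.2, (f x).2, by simpa using hx, isPair_iff_eq.1 hp⟩

-- The core of the argument, for `F` and `y` that are total, continuous and definable from standard
-- parameters.
open Classical in
theorem exists_euler_follow {F : R.Pt → R.Pt → R.Pt} [hFd : DefF₂ (Standards M) F] (hF : Cont₂ F)
    {y : R.Pt → R.Pt} [hyd : DefF (Standards M) y] (hy : Cont y) (hy0 : y 0 = 0) {c : R.Pt}
    (hc : std c.1) (hc0 : 0 < c)
    (hder : ∀ x ∈ Set.Icc 0 c, HasDerivOn (Set.Icc 0 c) y (F x (y x)) x)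
    {N x₀ y₀ : R.Pt} (hN : N ∈ R.naturals) (hN' : ¬ std N.1) (hx₀ : 0 ≤ x₀)
    (hx₀' : Near x₀ 0) (hy₀ : Near y₀ 0) :
    ∃ ε : R.Pt → R.Pt, IsPerturbation N ε ∧
      ∃ (u : R.Pt → R.Pt) (D : Set R.Pt) (yε : R.Pt → R.Pt),
        IsEulerSequence F N x₀ y₀ ε u ∧ IsEulerSolution N x₀ u D yε ∧
        (∀ x : R.Pt, 0 ≤ x → x ≤ c → x ∈ D ∧ y x = yε x) ∧
        (∀ k ∈ R.naturals, k < N ^ 2 → gridPoint N x₀ (k + 1) ≤ c →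
          ∃ t : R.Pt, gridPoint N x₀ k ≤ t ∧ t ≤ gridPoint N x₀ (k + 1) ∧
            y (gridPoint N x₀ (k + 1)) - y (gridPoint N x₀ k) = F t (y t) * (1 / N) ∧
            ε k = F t (y t) - F (gridPoint N x₀ k) (u k)) ∧
        (∀ k ∈ R.naturals, k < N ^ 2 → c < gridPoint N x₀ (k + 1) → ε k = 0) := by
  have := hFd.univ
  have := hyd.univ
  have hNpos : 0 < N := lt_of_std hN hN' (std_of_def _)
  have h1N : 0 < 1 / N := one_div_pos.2 hNpos
  have h1N' := near_one_div hN hN'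
  have hgrid : ∀ k, gridPoint N x₀ (k + 1) = gridPoint N x₀ k + 1 / N := fun k => by
    rw [gridPoint_add, one_mul]
  have hgrid0 : ∀ k ∈ R.naturals, 0 ≤ gridPoint N x₀ k := fun k hk =>
    add_nonneg hx₀ (mul_nonneg (nonneg_of_mem_naturals hk) h1N.le)
  have ig : DefF₂ Set.univ (fun k z : R.Pt => z + if gridPoint N x₀ (k + 1) ≤ c then
      y (gridPoint N x₀ (k + 1)) - y (gridPoint N x₀ k)
      else F (gridPoint N x₀ k) z * (1 / N)) := ⟨by infer_instance⟩
  obtain ⟨u, iu, hu0, hu⟩ := exists_recursion_pt (A := Set.univ) (R := R) _ y₀ (hg := ig)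
  -- The difference quotient replaces `F t (y t)` for a mean value point `t`, so the sequence is
  -- definable without choosing `t`.
  let ε : R.Pt → R.Pt := fun k => if gridPoint N x₀ (k + 1) ≤ c then
      (y (gridPoint N x₀ (k + 1)) - y (gridPoint N x₀ k)) * N - F (gridPoint N x₀ k) (u k) else 0
  have iε : DefF Set.univ ε := ⟨by simp only [ε]; infer_instance⟩
  have hεin : ∀ k, gridPoint N x₀ (k + 1) ≤ c → ε k =
      (y (gridPoint N x₀ (k + 1)) - y (gridPoint N x₀ k)) * N - F (gridPoint N x₀ k) (u k) :=
    fun k h => if_pos h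
  have hεout : ∀ k, c < gridPoint N x₀ (k + 1) → ε k = 0 := fun k h => if_neg (not_le.2 h)
  have heuler : ∀ k ∈ R.naturals, k < N ^ 2 →
      u (k + 1) = u k + (F (gridPoint N x₀ k) (u k) + ε k) * (1 / N) := by
    intro k hk _
    rw [hu k hk]
    by_cases h : gridPoint N x₀ (k + 1) ≤ c
    · rw [if_pos h, hεin k h]
      field_simp
      ring
    · rw [if_neg h, hεout k (not_le.1 h), add_zero]
  -- The increments of `y` telescope, which leaves only the initial discrepancy `y₀ - y x₀`.
  have hclosed : ∀ k ∈ R.naturals, gridPoint N x₀ k ≤ c →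
      u k = y₀ - y x₀ + y (gridPoint N x₀ k) := by
    intro k hk
    refine naturals_induction (fun k => gridPoint N x₀ k ≤ c →
      u k = y₀ - y x₀ + y (gridPoint N x₀ k)) ?_ ?_ hk
    · intro _
      rw [hu0, gridPoint, zero_mul, add_zero]; ring
    · intro k hk ih h
      rw [hu k hk, if_pos h, ih (by linarith [hgrid k])]
      ring
  have hnear : ∀ k ∈ R.naturals, gridPoint N x₀ k ≤ c → Near (u k) (y (gridPoint N x₀ k)) := by
    intro k hk h
    have h₁ := hy.near (std_of_def _) hx₀'
    rw [hy0] at h₁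
    have := (hy₀.sub h₁).add (Near.refl (y (gridPoint N x₀ k)))
    rwa [sub_zero, zero_add, ← hclosed k hk h] at this
  have hmvt : ∀ k ∈ R.naturals, gridPoint N x₀ (k + 1) ≤ c →
      ∃ t : R.Pt, gridPoint N x₀ k ≤ t ∧ t ≤ gridPoint N x₀ (k + 1) ∧
        y (gridPoint N x₀ (k + 1)) - y (gridPoint N x₀ k) = F t (y t) * (1 / N) ∧
        ε k = F t (y t) - F (gridPoint N x₀ k) (u k) := by
    intro k hk h
    have i : DefF Set.univ (fun x => F x (y x)) := ⟨by infer_instance⟩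
    have hsub : Set.Icc (gridPoint N x₀ k) (gridPoint N x₀ (k + 1)) ⊆ Set.Icc 0 c :=
      Set.Icc_subset_Icc (hgrid0 k hk) h
    obtain ⟨t, h₁, h₂, h₃⟩ := exists_deriv_eq_slope y (fun x => F x (y x))
      (p := gridPoint N x₀ k) (q := gridPoint N x₀ (k + 1)) (by linarith [hgrid k])
      (fun x hx => (hder x (hsub hx)).congr_subset hsub hx fun _ _ => rfl) (cont_comp₂ hF hy)
    have h₃ : y (gridPoint N x₀ (k + 1)) - y (gridPoint N x₀ k) = F t (y t) * (1 / N) := by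
      rw [h₃, hgrid, add_sub_cancel_left]
    refine ⟨t, h₁, h₂, h₃, ?_⟩
    rw [hεin k h, h₃, mul_assoc, one_div_mul_cancel hNpos.ne', mul_one]
  have hε : ∀ k ∈ R.naturals, k < N ^ 2 → Near (ε k) 0 := by
    intro k hk _
    rcases le_or_gt (gridPoint N x₀ (k + 1)) c with h | h
    · obtain ⟨t, h₁, h₂, -, h₃⟩ := hmvt k hk h
      rw [h₃, near_zero_iff]
      have hkc : gridPoint N x₀ k ≤ c := by linarith [hgrid k]
      -- Both `(t, y t)` and `(x_k, u k)` are infinitely close to the standard point `(s, y s)`,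
      -- where `F` is continuous.
      obtain ⟨s, hs, hks⟩ := exists_std_near (hgrid0 k hk) hc hkc
      have hts : Near t s := (h1N'.of_abs_le (abs_le.2
        ⟨by linarith, by linarith [hgrid k]⟩) : Near t (gridPoint N x₀ k)).trans hks
      have := Fact.std hs
      have hys : std (y s).1 := std_of_def _
      exact (hF.near hs hys hts (hy.near hs hts)).trans
        (hF.near hs hys hks ((hnear k hk hkc).trans (hy.near hs hks))).symm
    · rw [hεout k h]
      exact Near.refl 0
  obtain ⟨Y, hY⟩ := exists_shadow hN hN' x₀ u
  have hN2 : 0 < N ^ 2 := by positivity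
  have hYc : ∀ x : R.Pt, std x.1 → 0 ≤ x → x ≤ c → PairMem Y x.1 (y x).1 := by
    intro x hx hx0 hxc
    have := Fact.std hx
    obtain ⟨k, hk, hkN, hkx, hkc⟩ : ∃ k ∈ R.naturals, k < N ^ 2 ∧ Near x (gridPoint N x₀ k) ∧
        gridPoint N x₀ k ≤ c := by
      -- If `x ≤ x₀`, then `x` is squeezed between `0` and an infinitesimal, and `k = 0` works.
      -- Otherwise `x_k` is the last grid point not beyond `x`, and `k < N ^ 2` because the standard
      -- `x` is below `N`.
      rcases le_total x x₀ with h | h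
      · refine ⟨0, zero_mem_naturals, hN2, ?_, ?_⟩
        · rw [gridPoint, zero_mul, add_zero]
          exact hx₀'.of_abs_le (abs_le.2 ⟨by linarith, by linarith⟩)
        · have := near_iff.1 hx₀' c hc hc0
          rw [sub_zero, abs_of_nonneg hx₀] at this
          rw [gridPoint, zero_mul, add_zero]
          exact this.le
      · obtain ⟨k, hk, h₁, h₂⟩ := exists_floor (mul_nonneg (sub_nonneg.2 h) hNpos.le)
        have h₃ : k * (1 / N) ≤ x - x₀ := by
          rw [mul_one_div]; exact (div_le_iff₀ hNpos).2 h₁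
        have h₄ : x - x₀ < k * (1 / N) + 1 / N := by
          rw [mul_one_div, ← add_div]; exact (lt_div_iff₀ hNpos).2 h₂
        have hxN := lt_of_std hN hN' hx
        refine ⟨k, hk, ?_, h1N'.of_abs_le ?_, ?_⟩
        · have := mul_lt_mul_of_pos_right (by linarith : x - x₀ < N) hNpos
          rw [sq]
          linarith
        · exact abs_le.2 ⟨by unfold gridPoint; linarith, by unfold gridPoint; linarith⟩
        · unfold gridPoint; linarith
    have := hY.2.2 x (y x) hx (std_of_def _) hx0
    exact this.2 ⟨k, hk, hkN, hkx, ((hnear k hk hkc).trans (hy.near hx hkx.symm)).symm⟩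
  obtain ⟨D, yε, hD, hDc⟩ := exists_eulerSolution hY (shadow_unique hF hNpos hε heuler hY) hc hYc
  have i₁ : DefP Set.univ (fun v => R.toPt (v 0) ∈ {k : R.Pt | k ∈ R.naturals ∧ k < N ^ 2}) := by
    simp only [Set.mem_ofPred_eq]; infer_instance
  have i₂ : DefP Set.univ (fun v => R.toPt (v 0) ∈ {k : R.Pt | k ∈ R.naturals ∧ k ≤ N ^ 2}) := by
    simp only [Set.mem_ofPred_eq]; infer_instance
  exact ⟨ε, ⟨internalOn_of_defF _, hε⟩, u, D, yε, ⟨internalOn_of_defF _, hu0, heuler⟩, hD, hDc,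
    fun k hk _ => hmvt k hk, fun k _ _ => hεout k⟩

end Follow

/-! ### Total extensions of standard partial functions -/

section Total

variable {M : Type*} [SetUniverse M] [hS : Fact (IsSPOT M)] {R : RealLine M}

/-- The values of `F` at negative `x` are arbitrary, hence perhaps not definable; truncation at `0`
leaves only values recorded in the standard graph. -/
theorem StandardField.defF₂ {F : R.Pt → R.Pt → R.Pt} (hF : StandardField F) :
    DefF₂ (Standards M) (fun x z => F (max x 0) z) := by
  obtain ⟨G, hG, h⟩ := hF
  have := Fact.std hG
  refine ⟨DefP.of_iff (P := fun v =>
    opair (opair (max (R.toPt (v 1)) 0).1 (R.toPt (v 0)).1) (v 2) ∈ₘ G) (by infer_instance)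
    fun v => ?_⟩
  rw [h]
  constructor
  · intro e
    exact ⟨_, _, _, le_max_right _ _, isPair_opair _ _, by rw [e]; exact isPair_opair _ _⟩
  · rintro ⟨x, z, q, -, hq, hp⟩
    obtain ⟨e₁, e₂⟩ := (isPair_opair _ _).inj hp
    obtain ⟨e₃, e₄⟩ := (isPair_opair _ _).inj (e₁ ▸ hq)
    rw [e₂, Subtype.ext e₃, Subtype.ext e₄]

theorem StandardOn.defF_clamp {D : Set R.Pt} {y : R.Pt → R.Pt} (hy : StandardOn D y) {c : R.Pt}
    (hc : std c.1) (hc0 : 0 ≤ c) (hD : ∀ x, 0 ≤ x → x ≤ c → x ∈ D) :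
    DefF (Standards M) (fun x => y (max 0 (min x c))) := by
  obtain ⟨G, hG, h⟩ := hy
  have := Fact.std hG
  have := Fact.std hc
  refine ⟨DefP.of_iff (P := fun v => opair (max 0 (min (R.toPt (v 0)) c)).1 (v 1) ∈ₘ G)
    (by infer_instance) fun v => ?_⟩
  rw [h]
  constructor
  · intro e
    exact ⟨_, hD _ (le_max_left _ _) (max_le hc0 (min_le_right _ _)),
      by rw [e]; exact isPair_opair _ _⟩
  · rintro ⟨x, -, hp⟩
    obtain ⟨e₁, e₂⟩ := (isPair_opair _ _).inj hp
    rw [e₂, Subtype.ext e₁]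

end Total

end RealLine

theorem lemma5p1 {M : Type*} [SetUniverse M] (hM : IsSPOT M) (R : RealLine M)
    (F : R.Pt → R.Pt → R.Pt)
    (hF : RealLine.StandardField F) (hFc : RealLine.ContinuousField F)
    (N x₀ y₀ : R.Pt) (hN : N ∈ R.naturals) (hN' : ¬ RealLine.Limited N)
    (hx₀ : 0 ≤ x₀) (hx₀' : RealLine.Near x₀ 0) (hy₀ : RealLine.Near y₀ 0)
    (a : WithTop R.Pt) (ha : RealLine.StandardEndpoint a)
    (y : R.Pt → R.Pt) (hy : RealLine.StandardOn (RealLine.initialInterval a) y)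
    (hsol : RealLine.IsSolutionOn F a y)
    (c : R.Pt) (hc : SetUniverse.std c.1) (hc0 : 0 < c) (hca : (c : WithTop R.Pt) < a) :
    ∃ ε : R.Pt → R.Pt, RealLine.IsPerturbation N ε ∧
      ∃ (u : R.Pt → R.Pt) (D : Set R.Pt) (yε : R.Pt → R.Pt),
        RealLine.IsEulerSequence F N x₀ y₀ ε u ∧
        RealLine.IsEulerSolution N x₀ u D yε ∧
        (∀ x : R.Pt, 0 ≤ x → x ≤ c → x ∈ D ∧ y x = yε x) ∧
        -- the perturbation is given by mean-value points `t` of `y` up to `c`, and vanishes beyond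
        (∀ k ∈ R.naturals, k < N ^ 2 → RealLine.gridPoint N x₀ (k + 1) ≤ c →
          ∃ t : R.Pt, RealLine.gridPoint N x₀ k ≤ t ∧ t ≤ RealLine.gridPoint N x₀ (k + 1) ∧
            y (RealLine.gridPoint N x₀ (k + 1)) - y (RealLine.gridPoint N x₀ k) =
              F t (y t) * (1 / N) ∧
            ε k = F t (y t) - F (RealLine.gridPoint N x₀ k) (u k)) ∧
        (∀ k ∈ R.naturals, k < N ^ 2 → c < RealLine.gridPoint N x₀ (k + 1) → ε k = 0) := by
  have : Fact (IsSPOT M) := ⟨hM⟩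
  have hNs := RealLine.not_std_of_not_limited hN'
  have hD : ∀ x, 0 ≤ x → x ≤ c → x ∈ RealLine.initialInterval a := fun x h₁ h₂ =>
    ⟨h₁, (WithTop.coe_le_coe.2 h₂).trans_lt hca⟩
  have hclamp : ∀ x, 0 ≤ x → x ≤ c → y (max 0 (min x c)) = y x := fun x h₁ h₂ => by
    rw [min_eq_left h₂, max_eq_right h₁]
  have i₁ := hF.defF₂
  have i₂ := hy.defF_clamp hc hc0.le hD
  have hsub : Set.Icc 0 c ⊆ RealLine.initialInterval a := fun x hx => hD x hx.1 hx.2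
  -- Applied to `F (max x 0) z` and `y (max 0 (min x c))`. These agree with `F` and `y` at
  -- nonnegative `x` and on `[0, c]` respectively, so each conclusion translates back.
  obtain ⟨ε, hε, u, D, yε, hu, hD', hDc, hmvt, hout⟩ := RealLine.exists_euler_follow hFc.cont₂
    (RealLine.cont_clamp hsol.2 hD hc0.le) (by rw [hclamp 0 le_rfl hc0.le, hsol.1]) hc hc0
    (fun x hx => by
      rw [hclamp x hx.1 hx.2, max_eq_left hx.1]
      exact (hsol.2 x (hsub hx)).congr_subset hsub hx fun z hz => hclamp z hz.1 hz.2)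
    hN hNs hx₀ hx₀' hy₀
  have hNpos : 0 < N := RealLine.lt_of_std hN hNs (std_of_def _)
  have hgrid0 : ∀ k ∈ R.naturals, 0 ≤ RealLine.gridPoint N x₀ k := fun k hk =>
    add_nonneg hx₀ (mul_nonneg (RealLine.nonneg_of_mem_naturals hk) (one_div_pos.2 hNpos).le)
  refine ⟨ε, hε, u, D, yε, ⟨hu.1, hu.2.1, fun k hk hkN => ?_⟩, hD', fun x h₁ h₂ => ?_,
    fun k hk hkN h => ?_, hout⟩
  · have := hu.2.2 k hk hkN
    simpa only [max_eq_left (hgrid0 k hk)] using this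
  · have := hDc x h₁ h₂
    rwa [hclamp x h₁ h₂] at this
  · obtain ⟨t, h₁, h₂, h₃, h₄⟩ := hmvt k hk hkN h
    have hk0 := hgrid0 k hk
    rw [hclamp t (hk0.trans h₁) (h₂.trans h), max_eq_left (hk0.trans h₁)] at h₃ h₄
    rw [hclamp _ (hk0.trans (h₁.trans h₂)) h, hclamp _ hk0 (h₁.trans (h₂.trans h))] at h₃
    rw [max_eq_left hk0] at h₄
    exact ⟨t, h₁, h₂, h₃, h₄⟩
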